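/- Let $\sigma^0=\mathbb{I},\sigma^1,\sigma^2,\sigma^3$ be the Pauli matrices, and write $\sigma_i^k$ for $\sigma^k$ acting on qubit $i$. Fix $k\in\{1,2,3\}$. Consider a Hamiltonian $H=\sum_{e\in E}H_e$ on $n$ qubits, with $E$ finite and $H_e=w_eP_e\otimes\mathbb{I}_{[n]\setminus\{e_1,e_2\}}$, where $w_e\ge 0$, $e_1\neq e_2$ are qubits (several $e$ may act on the same pair) and $P_e\in\mathbb{C}^{4\times4}$ is an orthogonal projector of rank at least $k$ acting on qubits $e_1,e_2$. Let $\lambda_{\max}(H)$ be the maximum of $\mathrm{Tr}[H\rho]$ over density matrices $\rho$ on $n$ qubits. For real symmetric matrices $M$ with rows and columns labelled by $\mathbb{I}$ and the $\sigma_i^a$ ($i\in[n]$, $a\in\{1,2,3\}$), let $C_e$ be the symmetric matrix with $C_e(\sigma_{e_1}^a,\sigma_{e_2}^b)=\mathrm{Tr}[(\sigma^a\otimes\sigma^b)P_e]/8$, $C_e(\sigma_{e_1}^a,\mathbb{I})=\mathrm{Tr}[(\sigma^a\otimes\mathbb{I})P_e]/8$, $C_e(\sigma_{e_2}^b,\mathbb{I})=\mathrm{Tr}[(\mathbb{I}\otimes\sigma^b)P_e]/8$,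 and (up to symmetry) all other entries $0$. The SDP relaxation is: maximize $\sum_{e}w_e\left(\mathrm{Tr}[P_e]/4+\mathrm{Tr}[C_eM]\right)$ over such $M\succeq0$ and two-qubit density matrices $(\rho_e)_{e\in E}$ subject to $M(\mathbb{I},\mathbb{I})=1$; $M(\sigma_i^a,\sigma_i^a)=1$ and $M(\sigma_i^a,\sigma_i^b)=0$ for all $i$ and $a\ne b$; and, for all $e\in E$ and $a,b\in\{1,2,3\}$, $M(\sigma_{e_1}^a,\sigma_{e_2}^b)=\mathrm{Tr}[(\sigma^a\otimes\sigma^b)\rho_e]$, $M(\sigma_{e_1}^a,\mathbb{I})=\mathrm{Tr}[(\sigma^a\otimes\mathbb{I})\rho_e]$ and $M(\sigma_{e_2}^b,\mathbb{I})=\mathrm{Tr}[(\mathbb{I}\otimes\sigma^b)\rho_e]$. Let $M^*$ be the moment matrix of an optimal solution of the SDP, and let $\mathbf v_0,\mathbf v_{ia}\in\mathbb{R}^d$ be Cholesky vectors of it, i.e. vectors whose Gram matrix is $M^*$, with $\mathbf v_0$ belonging to $\mathbb{I}$ and $\mathbf v_{ia}$ to $\sigma_i^a$. Let $\mathbf r\sim\mathcal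 N(0,\mathbb{I}_d)$, and let $$\rho=\bigotimes_{i=1}^n\tfrac12\left(\mathbb{I}+\theta_{i1}\sigma^1+\theta_{i2}\sigma^2+\theta_{i3}\sigma^3\right),\qquad \theta_{ia}=\mathrm{sign}(\mathbf v_0\cdot\mathbf r)\,\frac{\mathbf v_{ia}\cdot\mathbf r}{\sqrt{(\mathbf v_{i1}\cdot\mathbf r)^2+(\mathbf v_{i2}\cdot\mathbf r)^2+(\mathbf v_{i3}\cdot\mathbf r)^2}},$$ be the random output of the rounding algorithm, where $\mathrm{sign}(x)=1$ for $x\ge0$ and $\mathrm{sign}(x)=-1$ for $x<0$. Then $\mathrm{Tr}[H\rho]$ is integrable and $$\mathbb{E}\left[\mathrm{Tr}[H\rho]\right]\ \ge\ \alpha(k)\sum_{e\in E}w_e\left(\frac{\mathrm{rank}(P_e)}{4}+\mathrm{Tr}[C_eM^*]\right)\ \ge\ \alpha(k)\,\lambda_{\max}(H),$$ where $\alpha(1)=\frac2\pi-\frac14\approx0.387$, $\alpha(2)=\frac{16}{9\pi}\approx0.565$ and $\alpha(3)=\frac38+\frac{11}{9\pi}\approx0.764$. -/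

import Mathlib

open scoped Matrix Kronecker ComplexOrder

noncomputable section

namespace QLH

/-- The Pauli matrices `σ⁰ = 𝕀, σ¹, σ², σ³`. -/
def pauli : Fin 4 → Matrix (Fin 2) (Fin 2) ℂ :=
  ![1, !![0, 1; 1, 0], !![0, -Complex.I; Complex.I, 0], !![1, 0; 0, -1]]

/-- Operators on two qubits (`4 × 4` complex matrices, indexed by pairs of basis labels). -/
abbrev TwoQubitOp : Type := Matrix (Fin 2 × Fin 2) (Fin 2 × Fin 2) ℂ

/-- Operators on `n` qubits (`2ⁿ × 2ⁿ` complex matrices, indexed by strings of basis labels). -/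
abbrev NQubitOp (n : ℕ) : Type := Matrix (Fin n → Fin 2) (Fin n → Fin 2) ℂ

/-- `Tr[σᵏ ⊗ σˡ X]` for a two-qubit operator `X`; this number is real when `X` is Hermitian,
the only case in which it is used. -/
def pauliTr (k l : Fin 4) (X : TwoQubitOp) : ℝ :=
  (Matrix.trace ((pauli k ⊗ₖ pauli l) * X)).re

/-- `O ⊗ 𝕀` on `n` qubits, where the first tensor factor of `O` acts on qubit `i`, the second
one on qubit `j`, and the identity acts on all the other qubits (for `i ≠ j`). -/
def extend {n : ℕ} (i j : Fin n) (O : TwoQubitOp) : NQubitOp n :=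
  Matrix.of fun x y =>
    if ∀ m, m ≠ i → m ≠ j → x m = y m then O (x i, x j) (y i, y j) else 0

/-- The tensor product `⨂ᵢ Aᵢ` of single-qubit operators. -/
def tensorProd {n : ℕ} (A : Fin n → Matrix (Fin 2) (Fin 2) ℂ) : NQubitOp n :=
  Matrix.of fun x y => ∏ i, A i (x i) (y i)

/-- Density matrices: positive semidefinite (in particular Hermitian) with trace one. -/
def IsDensity {ι : Type*} [Fintype ι] (ρ : Matrix ι ι ℂ) : Prop :=
  ρ.PosSemidef ∧ ρ.trace = 1

/-- `λ_max(H)`, the maximum of `Tr[H ρ]` over all density matrices `ρ`. -/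
def lambdaMax {n : ℕ} (H : NQubitOp n) : ℝ :=
  sSup {x : ℝ | ∃ ρ : NQubitOp n, IsDensity ρ ∧ x = (Matrix.trace (H * ρ)).re}

/-- An instance of the `2`-local Hamiltonian problem on `n` qubits. The terms are indexed by a
type `E`; the term of `e` acts on the two distinct qubits `fst e` and `snd e` and is
`weight e • op e ⊗ 𝕀`. Several terms may act on the same pair of qubits. -/
structure Instance (n : ℕ) (E : Type*) where
  fst : E → Fin n
  snd : E → Fin n
  fst_ne_snd : ∀ e, fst e ≠ snd e
  weight : E → ℝ
  op : E → TwoQubitOp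
  isHermitian : ∀ e, (op e).IsHermitian

/-- Labels of the rows and columns of moment matrices: `none` stands for `𝕀` and
`some (i, k)` for the Pauli operator `σᵏ⁺¹` on qubit `i` (so `k = 0, 1, 2` stand for
`σ¹, σ², σ³`). -/
abbrev Label (n : ℕ) : Type := Option (Fin n × Fin 3)

namespace Instance

variable {n : ℕ} {E : Type*}

/-- The full term `H_e` on `n` qubits. -/
def term (A : Instance n E) (e : E) : NQubitOp n :=
  (A.weight e : ℂ) • extend (A.fst e) (A.snd e) (A.op e)

/-- The Hamiltonian `∑ₑ H_e`. -/
def hamiltonian [Fintype E] (A : Instance n E) : NQubitOp n :=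
  ∑ e, A.term e

/-- The weights are nonnegative and the local operators are orthogonal projectors of rank at
least `k`. -/
def IsProjectorInstance (A : Instance n E) (k : ℕ) : Prop :=
  ∀ e, 0 ≤ A.weight e ∧ IsStarProjection (A.op e) ∧ k ≤ (A.op e).rank

/-- The value matrix `C_e`, holding the Pauli coefficients of `op e` (divided by `8`), except
that of `𝕀 ⊗ 𝕀`. -/
def valueMatrix (A : Instance n E) (e : E) : Matrix (Label n) (Label n) ℝ :=
  Matrix.of fun a b =>
    match a, b with
    | none, none => 0
    | some (i, k), none =>
        if i = A.fst e then pauliTr k.succ 0 (A.op e) / 8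
        else if i = A.snd e then pauliTr 0 k.succ (A.op e) / 8 else 0
    | none, some (j, l) =>
        if j = A.fst e then pauliTr l.succ 0 (A.op e) / 8
        else if j = A.snd e then pauliTr 0 l.succ (A.op e) / 8 else 0
    | some (i, k), some (j, l) =>
        if i = A.fst e ∧ j = A.snd e then pauliTr k.succ l.succ (A.op e) / 8
        else if i = A.snd e ∧ j = A.fst e then pauliTr l.succ k.succ (A.op e) / 8 else 0

/-- The objective function of the semidefinite relaxation. -/
def sdpObjective [Fintype E] (A : Instance n E) (M : Matrix (Label n) (Label n) ℝ) : ℝ :=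
  ∑ e, A.weight e * ((A.op e).trace.re / 4 + (A.valueMatrix e * M).trace)

/-- The constraints of the semidefinite relaxation, for a real moment matrix `M` and two-qubit
marginals `ρ e`. -/
structure SDPFeasible (A : Instance n E) (M : Matrix (Label n) (Label n) ℝ)
    (ρ : E → TwoQubitOp) : Prop where
  id_id : M none none = 1
  diag : ∀ i k, M (some (i, k)) (some (i, k)) = 1
  diag_block : ∀ i k l, k ≠ l → M (some (i, k)) (some (i, l)) = 0
  two_marginal : ∀ e k l,
    M (some (A.fst e, k)) (some (A.snd e, l)) = pauliTr k.succ l.succ (ρ e)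
  one_marginal_fst : ∀ e k, M (some (A.fst e, k)) none = pauliTr k.succ 0 (ρ e)
  one_marginal_snd : ∀ e l, M (some (A.snd e, l)) none = pauliTr 0 l.succ (ρ e)
  density : ∀ e, IsDensity (ρ e)
  posSemidef : M.PosSemidef

/-- `M` is the moment matrix of an optimal solution of the semidefinite relaxation. -/
def IsOptimalMoment [Fintype E] (A : Instance n E) (M : Matrix (Label n) (Label n) ℝ) : Prop :=
  (∃ ρ, A.SDPFeasible M ρ) ∧
    ∀ M' ρ', A.SDPFeasible M' ρ' → A.sdpObjective M' ≤ A.sdpObjective M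

end Instance

/-- `v` is a family of Cholesky vectors of `M`. -/
def IsCholesky {n d : ℕ} (M : Matrix (Label n) (Label n) ℝ)
    (v : Label n → EuclideanSpace ℝ (Fin d)) : Prop :=
  ∀ a b, M a b = inner ℝ (v a) (v b)

/-- The sign function with `sgn 0 = 1`. -/
def sgn (x : ℝ) : ℝ := if 0 ≤ x then 1 else -1

/-- The normalization `Q_i` of the rounding. -/
def normalizer {n d : ℕ} (v : Label n → EuclideanSpace ℝ (Fin d))
    (r : EuclideanSpace ℝ (Fin d)) (i : Fin n) : ℝ :=
  Real.sqrt (∑ k : Fin 3, (inner ℝ (v (some (i, k))) r) ^ 2)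

/-- The Bloch coordinates `θ_{ik}` of qubit `i`, with the global sign given by `v₀ · r`. -/
def blochCoord {n d : ℕ} (v : Label n → EuclideanSpace ℝ (Fin d))
    (r : EuclideanSpace ℝ (Fin d)) (i : Fin n) (k : Fin 3) : ℝ :=
  sgn (inner ℝ (v none) r) * (inner ℝ (v (some (i, k))) r / normalizer v r i)

/-- The output `⨂ᵢ (𝕀 + θ_{i1} σ¹ + θ_{i2} σ² + θ_{i3} σ³) / 2` of the rounding algorithm, for
the Cholesky vectors `v` and the drawn vector `r`. -/
def roundedState {n d : ℕ} (v : Label n → EuclideanSpace ℝ (Fin d))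
    (r : EuclideanSpace ℝ (Fin d)) : NQubitOp n :=
  tensorProd fun i => (1 / 2 : ℂ) • (1 + ∑ k : Fin 3, (blochCoord v r i k : ℂ) • pauli k.succ)

/-- The approximation ratios `α(1), α(2), α(3)` (and an irrelevant value elsewhere). -/
def alpha (k : ℕ) : ℝ :=
  if k = 1 then 2 / Real.pi - 1 / 4
  else if k = 2 then 16 / (9 * Real.pi)
  else if k = 3 then 3 / 8 + 11 / (9 * Real.pi)
  else 0

end QLH

end

/-! At a feasible point the objective term of `e` is `Tr[P_e ρ_e]` (`SDPFeasible.term_eq`), and the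
moments and reduced states of a genuine state form a feasible point. This gives the bound on
`lambdaMax`. Since the weights are nonnegative, it remains to show `E Tr[P_e ρ] ≥ α(k) Tr[P_e ρ_e]`
for each `e` separately (`alpha_mul_le_integral_term`).

The constraints make the three vectors of each qubit orthonormal, so up to the global sign its Bloch
vector is the direction of a Gaussian vector in three dimensions. The singular factors `G^(-1/2)`
and `G⁻¹`, where `G` is the squared length of that Gaussian vector, are superpositions of the
weights `exp(-l²G/2)`. Such a weight only rescales the Gaussian (`exists_rescaling`,
`integral_mul_radial`), so the required moments become one-dimensional integrals. The mean of a
Bloch coordinate is `c` times its SDP value, with `4/(3π) ≤ c ≤ 1/2`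
(`exists_integral_sgn_mul_ratio`).

Two-qubit correlations are only bounded from below. Each normalized coordinate splits into its best
linear approximation and a residual. The linear parts correlate to `8/(9π)` times the SDP value. The
residuals of one qubit are uncorrelated with variance `ε = 1/3 - 8/(9π)`, so expanding a square
bounds their contribution to the correlation sum with coefficients `t` below by `-ε(3 + |t|²)/2`
(`sum_integral_ratio_mul_ratio_ge`).

What is left is a scalar inequality (`ratio_inequality`). With `K = rank P_e`, write `4 Tr[P_e ρ_e]
= K + (p + q) + T`, separating local and two-qubit terms. Idempotence of `P_e` fixes the total
squared length of its Pauli coefficients. Both `ρ_e` and its spin flip, which negates `p + q`, give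
values in `[0, 1]`. The rest is linear arithmetic with bounds on `π`. -/

open scoped RealInnerProductSpace

namespace QLH
open MeasureTheory ProbabilityTheory

/-! ### Reweighting the standard Gaussian by Gaussian factors -/

section Gaussian

/-- Reweighting a one-dimensional Gaussian by a Gaussian factor, on characters. -/
lemma integral_gaussianReal_exp_neg_mul_cexp {l : ℝ} (hl : 0 ≤ l) (t : ℝ) :
    ∫ u, ((Real.exp (-(l * u ^ 2 / 2)) : ℝ) : ℂ) * Complex.exp (u * t * Complex.I)
        ∂gaussianReal 0 1 =
      ((√(1 + l))⁻¹ : ℝ) * Complex.exp (-((√(1 + l))⁻¹ * t : ℝ) ^ 2 / 2) := by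
  set κ : ℝ := (√(1 + l))⁻¹ with hκ
  have hκ0 : 0 < κ := by positivity
  have hκ2 : κ ^ 2 * (1 + l) = 1 := by
    rw [hκ, inv_pow, Real.sq_sqrt (by positivity)]
    exact inv_mul_cancel₀ (by positivity)
  let V : NNReal := ⟨κ ^ 2, by positivity⟩
  have hV : V ≠ 0 := by
    intro h
    have := congrArg NNReal.toReal h
    have h2 : (V : ℝ) = κ ^ 2 := rfl
    rw [h2] at this
    have h3 : κ ^ 2 = 0 := by simpa using this
    exact hκ0.ne' (pow_eq_zero_iff two_ne_zero |>.1 h3)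
  have key := charFun_gaussianReal (μ := 0) (v := V) t
  rw [charFun_apply_real, integral_gaussianReal_eq_integral_smul hV] at key
  rw [integral_gaussianReal_eq_integral_smul (by simp)]
  -- Completing the exponent: as `1 + l = κ⁻²`, the weight turns the density of `N(0, 1)` into `κ`
  -- times that of `N(0, κ²)`.
  have hpdf : ∀ x : ℝ, gaussianPDFReal 0 1 x * Real.exp (-(l * x ^ 2 / 2)) =
      κ * gaussianPDFReal 0 V x := by
    intro x
    simp only [gaussianPDFReal, sub_zero, NNReal.coe_one, mul_one]
    have h2 : (V : ℝ) = κ ^ 2 := rfl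
    rw [h2, mul_assoc, ← Real.exp_add, Real.sqrt_mul (by positivity) (κ ^ 2),
      Real.sqrt_sq hκ0.le, mul_inv]
    have : -x ^ 2 / (2 * κ ^ 2) = -x ^ 2 / 2 + -(l * x ^ 2 / 2) := by
      field_simp
      linear_combination (x ^ 2) * hκ2
    rw [this]
    field_simp
  have : ∀ x : ℝ, gaussianPDFReal 0 1 x •
      (((Real.exp (-(l * x ^ 2 / 2)) : ℝ) : ℂ) * Complex.exp (x * t * Complex.I)) =
      (κ : ℂ) * (gaussianPDFReal 0 V x • Complex.exp (t * x * Complex.I)) := by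
    intro x
    rw [Complex.real_smul, Complex.real_smul, ← mul_assoc, ← mul_assoc, ← Complex.ofReal_mul,
      ← Complex.ofReal_mul, hpdf, mul_comm (t : ℂ)]
    push_cast
    ring
  simp_rw [this]
  rw [integral_const_mul, key]
  congr 2
  have h2 : ((V : ℝ) : ℂ) = (κ : ℂ) ^ 2 := by
    have : (V : ℝ) = κ ^ 2 := rfl
    rw [this]; push_cast; ring
  rw [h2]
  push_cast
  ring

variable {F : Type*} [NormedAddCommGroup F] [InnerProductSpace ℝ F]

/-- The diagonal operator `b i ↦ c i • b i`. -/
noncomputable def diagMap {ι : Type*} [Fintype ι] (b : OrthonormalBasis ι ℝ F) (c : ι → ℝ) (r : F) : F :=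
  ∑ i, (c i * ⟪b i, r⟫) • b i

lemma inner_diagMap {ι : Type*} [Fintype ι] (b : OrthonormalBasis ι ℝ F) (c : ι → ℝ)
    (y r : F) : ⟪y, diagMap b c r⟫ = ⟪diagMap b c y, r⟫ := by
  simp only [diagMap, inner_sum, sum_inner, real_inner_smul_left, real_inner_smul_right]
  refine Finset.sum_congr rfl fun i _ => ?_
  rw [real_inner_comm y (b i)]; ring

lemma diagMap_basis {ι : Type*} [Fintype ι] (b : OrthonormalBasis ι ℝ F)
    (c : ι → ℝ) (i : ι) : diagMap b c (b i) = c i • b i := by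
  classical
  unfold diagMap
  rw [Finset.sum_eq_single i]
  · simp
  · intro j _ hj
    rw [b.orthonormal.2 hj]; simp
  · simp

variable [FiniteDimensional ℝ F] [MeasurableSpace F] [BorelSpace F]

lemma measurable_diagMap {ι : Type*} [Fintype ι] (b : OrthonormalBasis ι ℝ F) (c : ι → ℝ) :
    Measurable (diagMap b c) := by
  unfold diagMap
  fun_prop

lemma integral_exp_neg_mul_cexp_inner {ι : Type*} [Fintype ι] (b : OrthonormalBasis ι ℝ F)
    {l : ι → ℝ} (hl : ∀ i, 0 ≤ l i) (t : F) :
    ∫ r, ((Real.exp (-(∑ i, l i * ⟪b i, r⟫ ^ 2 / 2)) : ℝ) : ℂ) *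
        Complex.exp (⟪r, t⟫ * Complex.I) ∂stdGaussian F =
      (∏ i, (√(1 + l i))⁻¹ : ℝ) *
        Complex.exp (-(‖diagMap b (fun i => (√(1 + l i))⁻¹) t‖ : ℂ) ^ 2 / 2) := by
  classical
  rw [stdGaussian_eq_map_pi_orthonormalBasis b, integral_map
    (Measurable.aemeasurable (by fun_prop)) (Measurable.aestronglyMeasurable (by fun_prop))]
  have hb : ∀ (x : ι → ℝ) i, ⟪b i, ∑ j, x j • b j⟫ = x i := fun x i => by
    rw [b.orthonormal.inner_right_fintype]
  have h1 : ∀ x : ι → ℝ,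
      ((Real.exp (-(∑ i, l i * ⟪b i, ∑ j, x j • b j⟫ ^ 2 / 2)) : ℝ) : ℂ) *
        Complex.exp (⟪∑ j, x j • b j, t⟫ * Complex.I) =
      ∏ i, (((Real.exp (-(l i * x i ^ 2 / 2)) : ℝ) : ℂ) *
        Complex.exp (x i * ⟪b i, t⟫ * Complex.I)) := by
    intro x
    simp_rw [hb]
    rw [Finset.prod_mul_distrib, ← Complex.exp_sum, ← Complex.ofReal_prod, ← Real.exp_sum,
      Finset.sum_neg_distrib, ← Finset.sum_mul]
    simp [sum_inner, real_inner_smul_left]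
  simp_rw [h1]
  rw [integral_fintype_prod_eq_prod (f := fun i (u : ℝ) =>
    ((Real.exp (-(l i * u ^ 2 / 2)) : ℝ) : ℂ) * Complex.exp (u * ⟪b i, t⟫ * Complex.I))]
  simp_rw [integral_gaussianReal_exp_neg_mul_cexp (hl _)]
  rw [Finset.prod_mul_distrib, ← Complex.exp_sum, Complex.ofReal_prod]
  congr 2
  have : ‖diagMap b (fun i => (√(1 + l i))⁻¹) t‖ ^ 2 =
      ∑ i, ((√(1 + l i))⁻¹ * ⟪b i, t⟫) ^ 2 := by
    rw [← b.sum_sq_inner_right]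
    refine Finset.sum_congr rfl fun i _ => ?_
    rw [diagMap, b.orthonormal.inner_right_fintype]
  rw [← Complex.ofReal_pow, this]
  push_cast
  rw [← Finset.sum_neg_distrib, Finset.sum_div]

/-- A Gaussian reweighting of the standard Gaussian measure is, up to a constant factor, an
anisotropic rescaling of it. -/
lemma integral_exp_neg_mul {ι : Type*} [Fintype ι] (b : OrthonormalBasis ι ℝ F)
    {l : ι → ℝ} (hl : ∀ i, 0 ≤ l i) {f : F → ℝ} (hf : Measurable f) :
    ∫ r, Real.exp (-(∑ i, l i * ⟪b i, r⟫ ^ 2 / 2)) * f r ∂stdGaussian F =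
      (∏ i, (√(1 + l i))⁻¹) *
        ∫ r, f (diagMap b (fun i => (√(1 + l i))⁻¹) r) ∂stdGaussian F := by
  set w : F → ℝ := fun r => Real.exp (-(∑ i, l i * ⟪b i, r⟫ ^ 2 / 2)) with hw
  set S := diagMap b (fun i => (√(1 + l i))⁻¹) with hS
  set D : ℝ := ∏ i, (√(1 + l i))⁻¹ with hD
  have hD0 : 0 ≤ D := Finset.prod_nonneg fun i _ => by positivity
  have hSm : Measurable S := measurable_diagMap _ _
  have hwm : Measurable w := by rw [hw]; fun_prop
  have hw1 : ∀ r, w r ≤ 1 := fun r => by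
    rw [hw]; simp only [Real.exp_le_one_iff, Left.neg_nonpos_iff]
    exact Finset.sum_nonneg fun i _ => by have := hl i; positivity
  have hw0 : ∀ r, 0 ≤ w r := fun r => (Real.exp_pos _).le
  -- Equality of the finite measures is proved through characteristic functions. The formula then
  -- holds for every measurable `f`, integrable or not.
  have hmeas : (stdGaussian F).withDensity (fun r => ENNReal.ofReal (w r)) =
      ENNReal.ofReal D • (stdGaussian F).map S := by
    have : IsFiniteMeasure ((stdGaussian F).withDensity (fun r => ENNReal.ofReal (w r))) := by
      refine isFiniteMeasure_withDensity_ofReal (Integrable.hasFiniteIntegral (f := w) ?_)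
      exact Integrable.of_bound hwm.aestronglyMeasurable 1
        (Filter.Eventually.of_forall fun r => by rw [Real.norm_of_nonneg (hw0 r)]; exact hw1 r)
    have : IsFiniteMeasure (ENNReal.ofReal D • (stdGaussian F).map S) := by
      have := Measure.isProbabilityMeasure_map (μ := stdGaussian F) hSm.aemeasurable
      exact Measure.smul_finite _ ENNReal.ofReal_ne_top
    apply Measure.ext_of_charFun
    ext t
    rw [charFun_apply, charFun_apply, integral_withDensity_eq_integral_toReal_smul
      (by fun_prop) (Filter.Eventually.of_forall fun r => ENNReal.ofReal_lt_top),
      integral_smul_measure, integral_map hSm.aemeasurable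
        (Measurable.aestronglyMeasurable (by fun_prop))]
    simp_rw [ENNReal.toReal_ofReal (hw0 _), ENNReal.toReal_ofReal hD0, Complex.real_smul]
    rw [integral_exp_neg_mul_cexp_inner b hl t, ← charFun_stdGaussian, charFun_apply]
    have h : ∀ x, ⟪S x, t⟫ = ⟪x, S t⟫ := fun x => by
      rw [real_inner_comm, hS, inner_diagMap, real_inner_comm]
    simp_rw [h]
    rfl
  have := congrArg (fun m => ∫ r, f r ∂m) hmeas
  beta_reduce at this
  rw [integral_withDensity_eq_integral_toReal_smul
      (by fun_prop) (Filter.Eventually.of_forall fun r => ENNReal.ofReal_lt_top),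
      integral_smul_measure, integral_map hSm.aemeasurable hf.aestronglyMeasurable] at this
  simpa [ENNReal.toReal_ofReal (hw0 _), ENNReal.toReal_ofReal hD0] using this

end Gaussian

/-! ### Linear and sign moments of a Gaussian vector -/

section GaussianMoments

variable {F : Type*} [NormedAddCommGroup F] [InnerProductSpace ℝ F]

/-- The squared length of the projection of `r` onto the span of `x`. -/
noncomputable def projSq (x : Fin 3 → F) (r : F) : ℝ := ∑ a, ⟪x a, r⟫ ^ 2

lemma projSq_nonneg (x : Fin 3 → F) (r : F) : 0 ≤ projSq x r :=
  Finset.sum_nonneg fun _ _ => sq_nonneg _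

lemma inner_sq_le_projSq (x : Fin 3 → F) (r : F) (a : Fin 3) : ⟪x a, r⟫ ^ 2 ≤ projSq x r :=
  Finset.single_le_sum (f := fun a => ⟪x a, r⟫ ^ 2) (fun _ _ => sq_nonneg _) (Finset.mem_univ a)

lemma abs_inner_div_sqrt_projSq_le (x : Fin 3 → F) (r : F) (a : Fin 3) :
    |⟪x a, r⟫ / √(projSq x r)| ≤ 1 := by
  rw [abs_div, abs_of_nonneg (Real.sqrt_nonneg _)]
  refine div_le_one_of_le₀ ?_ (Real.sqrt_nonneg _)
  rw [← Real.sqrt_sq_eq_abs]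
  exact Real.sqrt_le_sqrt (inner_sq_le_projSq x r a)

lemma projSq_le_norm_sq {x : Fin 3 → F} (hx : Orthonormal ℝ x) (v : F) :
    projSq x v ≤ ‖v‖ ^ 2 := by
  have := hx.sum_inner_products_le v (s := Finset.univ)
  simpa [projSq, Real.norm_eq_abs, sq_abs] using this

variable [FiniteDimensional ℝ F] [MeasurableSpace F] [BorelSpace F]

lemma measurable_projSq (x : Fin 3 → F) : Measurable (projSq x) := by
  unfold projSq; fun_prop

lemma measurable_sgn : Measurable sgn := by
  unfold sgn
  exact Measurable.ite measurableSet_Ici measurable_const measurable_const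

lemma abs_sgn (x : ℝ) : |sgn x| = 1 := by
  unfold sgn; split_ifs <;> simp

lemma sgn_mul_self (x : ℝ) : sgn x * x = |x| := by
  unfold sgn
  split_ifs with h
  · rw [abs_of_nonneg h, one_mul]
  · rw [abs_of_neg (not_le.1 h)]; ring

/-- Extend `x` to an orthonormal basis, with weight `l` on the vectors of `x` and `0` on the others.
The map `S` then shrinks the span of `x` and fixes its orthogonal complement; the factor `(√(1 +
l))⁻¹ ^ 3` is its determinant. -/
lemma exists_rescaling {x : Fin 3 → F} (hx : Orthonormal ℝ x) {l : ℝ} (hl : 0 ≤ l) :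
    ∃ S : F → F, Measurable S ∧ (∀ y r, ⟪y, S r⟫ = ⟪S y, r⟫) ∧
      (∀ a, S (x a) = (√(1 + l))⁻¹ • x a) ∧
      (∀ v, ‖S v‖ ^ 2 = ‖v‖ ^ 2 - (1 - (1 + l)⁻¹) * projSq x v) ∧
      ∀ f : F → ℝ, Measurable f →
        ∫ r, Real.exp (-(l * projSq x r / 2)) * f r ∂stdGaussian F =
          (√(1 + l))⁻¹ ^ 3 * ∫ r, f (S r) ∂stdGaussian F := by
  classical
  obtain ⟨u, b, hu, hb⟩ := ((orthonormal_subtype_range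
    hx.linearIndependent.injective).2 hx).exists_orthonormalBasis_extension
  let e : Fin 3 → u := fun a => ⟨x a, hu ⟨a, rfl⟩⟩
  have he : Function.Injective e := fun a a' h =>
    hx.linearIndependent.injective (congrArg Subtype.val h)
  have hbe : ∀ a, b (e a) = x a := fun a => by rw [hb]
  let t : Finset u := Finset.univ.image e
  let c : u → ℝ := fun i => if i ∈ t then l else 0
  have hc : ∀ i, 0 ≤ c i := fun i => by dsimp only [c]; split_ifs <;> simp [hl]
  have hκ : ∀ i, (√(1 + c i))⁻¹ = if i ∈ t then (√(1 + l))⁻¹ else 1 := fun i => by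
    dsimp only [c]; split_ifs <;> simp
  have hsum : ∀ (g : u → ℝ), ∑ i, (if i ∈ t then g i else 0) = ∑ a, g (e a) := fun g => by
    rw [Finset.sum_ite_mem, Finset.univ_inter, Finset.sum_image he.injOn]
  refine ⟨diagMap b (fun i => (√(1 + c i))⁻¹), measurable_diagMap _ _,
    fun y r => inner_diagMap _ _ _ _, fun a => ?_, fun v => ?_, fun f hf => ?_⟩
  · rw [← hbe, diagMap_basis, hκ, if_pos (Finset.mem_image_of_mem e (Finset.mem_univ a))]
  · rw [← b.sum_sq_inner_right, ← b.sum_sq_inner_right, projSq, Finset.mul_sum]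
    simp_rw [← hbe]
    rw [← hsum (fun i => (1 - (1 + l)⁻¹) * ⟪b i, v⟫ ^ 2), ← Finset.sum_sub_distrib]
    refine Finset.sum_congr rfl fun i _ => ?_
    rw [diagMap, b.orthonormal.inner_right_fintype, hκ]
    split_ifs
    · rw [mul_pow, inv_pow, Real.sq_sqrt (by positivity)]; ring
    · ring
  · have := integral_exp_neg_mul b hc hf
    have h1 : ∀ r, ∑ i, c i * ⟪b i, r⟫ ^ 2 / 2 = l * projSq x r / 2 := fun r => by
      rw [projSq, Finset.mul_sum, Finset.sum_div]
      simp_rw [← hbe]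
      rw [← hsum (fun i => l * ⟪b i, r⟫ ^ 2 / 2)]
      refine Finset.sum_congr rfl fun i _ => ?_
      dsimp only [c]; split_ifs <;> simp
    have h2 : ∏ i, (√(1 + c i))⁻¹ = (√(1 + l))⁻¹ ^ 3 := by
      simp_rw [hκ]
      rw [Finset.prod_ite_mem, Finset.univ_inter, Finset.prod_const,
        Finset.card_image_of_injective _ he]
      simp
    rw [h2] at this
    simp_rw [h1] at this
    exact this

lemma memLp_inner_stdGaussian (y : F) : MemLp (fun r => ⟪y, r⟫) 2 (stdGaussian F) :=
  IsGaussian.memLp_dual (stdGaussian F) (innerSL ℝ y) 2 (by simp)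

lemma integrable_inner_stdGaussian (y : F) : Integrable (fun r => ⟪y, r⟫) (stdGaussian F) :=
  (memLp_inner_stdGaussian y).integrable (by norm_num)

lemma integral_inner_mul_inner_stdGaussian (x y : F) :
    ∫ r, ⟪x, r⟫ * ⟪y, r⟫ ∂stdGaussian F = ⟪x, y⟫ := by
  have h := congrArg (fun B => B x y) (covarianceBilin_stdGaussian (E := F))
  change _ = ⟪x, y⟫ at h
  rw [covarianceBilin_apply IsGaussian.memLp_two_id] at h
  simpa [integral_id_stdGaussian] using h

lemma map_inner_stdGaussian (y : F) :
    (stdGaussian F).map (fun r => ⟪y, r⟫) = gaussianReal 0 (‖y‖ ^ 2).toNNReal := by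
  have := IsGaussian.map_eq_gaussianReal (μ := stdGaussian F) (innerSL ℝ y)
  rw [variance_dual_stdGaussian, integral_strongDual_stdGaussian] at this
  simpa using this

lemma ae_inner_ne_zero {y : F} (hy : y ≠ 0) : ∀ᵐ r ∂stdGaussian F, ⟪y, r⟫ ≠ 0 := by
  have hv : (‖y‖ ^ 2).toNNReal ≠ 0 := by
    have := norm_pos_iff.2 hy
    simp [this.ne']
  have hna := nullSingletonClass_gaussianReal (μ := 0) hv
  have : ∀ᵐ u ∂((stdGaussian F).map (fun r => ⟪y, r⟫)), u ≠ 0 := by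
    rw [map_inner_stdGaussian]
    exact ae_iff.2 (by simp)
  exact ae_of_ae_map (f := fun r => ⟪y, r⟫) (p := fun u => u ≠ 0)
    (Measurable.aemeasurable (by fun_prop)) this

lemma integral_abs_gaussianReal : ∫ u, |u| ∂gaussianReal 0 1 = √(2 / Real.pi) := by
  rw [integral_gaussianReal_eq_integral_smul (by simp)]
  have h1 : ∀ x : ℝ, gaussianPDFReal 0 1 x • |x| =
      (fun y => (√(2 * Real.pi))⁻¹ * (y * Real.exp (-y ^ 2 / 2))) |x| := fun x => by
    simp [gaussianPDFReal]; ring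
  refine (integral_congr_ae (Filter.Eventually.of_forall h1)).trans ?_
  rw [integral_comp_abs (f := fun y => (√(2 * Real.pi))⁻¹ * (y * Real.exp (-y ^ 2 / 2))),
    integral_const_mul]
  have hd : ∀ x ∈ Set.Ici (0 : ℝ), HasDerivAt (fun y : ℝ => -Real.exp (-y ^ 2 / 2))
      (x * Real.exp (-x ^ 2 / 2)) x := fun x _ => by
    have : HasDerivAt (fun y : ℝ => -y ^ 2 / 2) (-x) x := by
      have h := ((hasDerivAt_pow 2 x).neg).div_const 2
      exact h.congr_deriv (by push_cast; ring)
    exact this.exp.neg.congr_deriv (by ring)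
  have ht : Filter.Tendsto (fun y : ℝ => -Real.exp (-y ^ 2 / 2)) Filter.atTop (nhds 0) := by
    rw [← neg_zero]
    refine Filter.Tendsto.neg (Real.tendsto_exp_atBot.comp ?_)
    have : (fun y : ℝ => -y ^ 2 / 2) = fun y => -(y ^ 2 * (1 / 2)) := by ext; ring
    rw [this]
    exact Filter.tendsto_neg_atTop_atBot.comp
      ((Filter.tendsto_pow_atTop two_ne_zero).atTop_mul_const (by norm_num))
  rw [integral_Ioi_of_hasDerivAt_of_nonneg' hd
    (fun x hx => mul_nonneg (Set.mem_Ioi.1 hx).le (Real.exp_pos _).le) ht]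
  have h2 := Real.sqrt_nonneg 2
  have h2' : √2 ^ 2 = 2 := Real.sq_sqrt (by norm_num)
  have h3 := Real.sqrt_pos.2 Real.pi_pos
  rw [Real.sqrt_mul (by norm_num), Real.sqrt_div (by norm_num)]
  have h4 : 0 < √2 := by positivity
  simp
  field_simp
  linarith

lemma integral_abs_inner_stdGaussian (y : F) :
    ∫ r, |⟪y, r⟫| ∂stdGaussian F = √(2 / Real.pi) * ‖y‖ := by
  have h1 : ∫ r, |⟪y, r⟫| ∂stdGaussian F =
      ∫ u, |u| ∂((stdGaussian F).map (fun r => ⟪y, r⟫)) := by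
    rw [integral_map (Measurable.aemeasurable (by fun_prop))
      (Measurable.aestronglyMeasurable (by fun_prop))]
  have h2 := gaussianReal_map_const_mul (μ := 0) (v := 1) ‖y‖
  have h3 : gaussianReal (‖y‖ * 0) (NNReal.mk (‖y‖ ^ 2) (sq_nonneg _) * 1) =
      gaussianReal 0 (‖y‖ ^ 2).toNNReal := by
    congr 1
    · ring
    · rw [mul_one]; ext; simp
  rw [h1, map_inner_stdGaussian, ← h3, ← h2, integral_map (Measurable.aemeasurable (by fun_prop))
      (Measurable.aestronglyMeasurable (by fun_prop))]
  simp_rw [abs_mul, abs_norm]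
  rw [integral_const_mul, integral_abs_gaussianReal, mul_comm]

/-- The reflection in the hyperplane orthogonal to `z` preserves the Gaussian measure and fixes `v`,
but flips the sign of `⟪z, r⟫`. -/
lemma integral_sgn_mul_inner_of_inner_eq_zero {v z : F} (h : ⟪v, z⟫ = 0) :
    ∫ r, sgn ⟪v, r⟫ * ⟪z, r⟫ ∂stdGaussian F = 0 := by
  let R : F ≃ₗᵢ[ℝ] F := (ℝ ∙ z)ᗮ.reflection
  have hRz : R z = -z := Submodule.reflection_orthogonalComplement_singleton_eq_neg z
  have hRv : R v = v := by
    apply Submodule.reflection_mem_subspace_eq_self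
    rw [Submodule.mem_orthogonal_singleton_iff_inner_left]
    exact h
  have hsymm : ∀ y r, ⟪y, R r⟫ = ⟪R y, r⟫ := fun y r => by
    rw [← R.inner_map_map (R y) r]
    congr 1
    exact (Submodule.reflection_reflection _ _).symm
  have h1 : ∫ r, sgn ⟪v, r⟫ * ⟪z, r⟫ ∂stdGaussian F =
      ∫ r, sgn ⟪v, R r⟫ * ⟪z, R r⟫ ∂stdGaussian F := by
    conv_lhs => rw [← stdGaussian_map R]
    rw [integral_map R.continuous.measurable.aemeasurable]
    have := measurable_sgn
    exact Measurable.aestronglyMeasurable (by fun_prop)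
  simp_rw [hsymm, hRz, hRv, inner_neg_left, mul_neg] at h1
  rw [integral_neg] at h1
  linarith

lemma integrable_sgn_mul_inner (v z : F) :
    Integrable (fun r => sgn ⟪v, r⟫ * ⟪z, r⟫) (stdGaussian F) := by
  refine (integrable_inner_stdGaussian z).bdd_mul (c := 1) ?_ ?_
  · exact (measurable_sgn.comp (by fun_prop)).aestronglyMeasurable
  · exact Filter.Eventually.of_forall fun r => by rw [Real.norm_eq_abs, abs_sgn]

/-- Only the component of `y` along `v` contributes, and there the sign turns `⟪v, r⟫` into its
absolute value. -/
lemma integral_sgn_mul_inner {v : F} (hv : v ≠ 0) (y : F) :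
    ∫ r, sgn ⟪v, r⟫ * ⟪y, r⟫ ∂stdGaussian F = √(2 / Real.pi) * (⟪v, y⟫ / ‖v‖) := by
  have hn : ‖v‖ ≠ 0 := norm_ne_zero_iff.2 hv
  set s : ℝ := ⟪v, y⟫ / ‖v‖ ^ 2 with hs
  have hz : ⟪v, y - s • v⟫ = 0 := by
    rw [inner_sub_right, inner_smul_right, real_inner_self_eq_norm_sq, hs]
    field_simp
    simp
  have h0 := integral_sgn_mul_inner_of_inner_eq_zero hz
  have h1 : ∀ r, sgn ⟪v, r⟫ * ⟪y, r⟫ = sgn ⟪v, r⟫ * ⟪y - s • v, r⟫ + s * |⟪v, r⟫| := fun r => by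
    rw [inner_sub_left, real_inner_smul_left, ← sgn_mul_self]; ring
  simp_rw [h1]
  rw [integral_add (integrable_sgn_mul_inner _ _)
    ((integrable_inner_stdGaussian v).abs.const_mul s), h0, integral_const_mul,
    integral_abs_inner_stdGaussian, hs]
  field_simp
  simp

end GaussianMoments

/-! ### One-dimensional integrals over the weight parameter -/

section RadialIntegrals

lemma hasDerivAt_inv_sqrt (x : ℝ) :
    HasDerivAt (fun l : ℝ => (√(1 + l ^ 2))⁻¹) (-x * (√(1 + x ^ 2))⁻¹ ^ 3) x := by
  have h0 : (0 : ℝ) < 1 + x ^ 2 := by positivity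
  have h1 : HasDerivAt (fun l : ℝ => 1 + l ^ 2) (2 * x) x := by
    simpa using (hasDerivAt_pow 2 x).const_add 1
  have h2 := (h1.sqrt h0.ne').inv (Real.sqrt_pos.2 h0).ne'
  refine h2.congr_deriv ?_
  have := Real.sqrt_pos.2 h0
  field_simp

lemma inv_sqrt_sq (x : ℝ) : (√(1 + x ^ 2))⁻¹ ^ 2 * (1 + x ^ 2) = 1 := by
  have h0 : (0 : ℝ) < 1 + x ^ 2 := by positivity
  rw [inv_pow, Real.sq_sqrt h0.le]
  exact inv_mul_cancel₀ h0.ne'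

lemma tendsto_inv_sqrt :
    Filter.Tendsto (fun l : ℝ => (√(1 + l ^ 2))⁻¹) Filter.atTop (nhds 0) := by
  refine Filter.Tendsto.inv_tendsto_atTop (Real.tendsto_sqrt_atTop.comp ?_)
  exact Filter.tendsto_atTop_add_const_left _ _ (Filter.tendsto_pow_atTop two_ne_zero)

lemma tendsto_mul_inv_sqrt :
    Filter.Tendsto (fun l : ℝ => l * (√(1 + l ^ 2))⁻¹) Filter.atTop (nhds 1) := by
  have h : Filter.Tendsto (fun l : ℝ => √(1 - (√(1 + l ^ 2))⁻¹ ^ 2)) Filter.atTop (nhds 1) := by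
    have := ((tendsto_inv_sqrt.pow 2).const_sub 1).sqrt
    simpa using this
  refine h.congr' ?_
  filter_upwards [Filter.eventually_ge_atTop 0] with l hl
  have := inv_sqrt_sq l
  rw [show 1 - (√(1 + l ^ 2))⁻¹ ^ 2 = (l * (√(1 + l ^ 2))⁻¹) ^ 2 by linear_combination -this]
  exact Real.sqrt_sq (by positivity)

/-- Substituting `l = tan φ` turns the integrand into `cos³ φ`, with antiderivative `sin φ - sin³ φ
/ 3`. -/
lemma hasDerivAt_cube_sub (x : ℝ) :
    HasDerivAt (fun l : ℝ => l * (√(1 + l ^ 2))⁻¹ - (l * (√(1 + l ^ 2))⁻¹) ^ 3 / 3)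
      ((√(1 + x ^ 2))⁻¹ ^ 5) x := by
  have h1 := (hasDerivAt_id x).mul (hasDerivAt_inv_sqrt x)
  have h2 := h1.sub ((h1.pow 3).div_const 3)
  have h3 := inv_sqrt_sq x
  refine h2.congr_deriv ?_
  simp only [id, Pi.mul_apply]
  set k := (√(1 + x ^ 2))⁻¹
  have e1 : 1 * k + x * (-x * k ^ 3) = k ^ 3 := by linear_combination -k * h3
  rw [e1]
  push_cast
  linear_combination -k ^ 3 * h3

lemma integrableOn_inv_sqrt_pow_five :
    IntegrableOn (fun l : ℝ => (√(1 + l ^ 2))⁻¹ ^ 5) (Set.Ioi 0) :=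
  integrableOn_Ioi_deriv_of_nonneg' (fun x _ => hasDerivAt_cube_sub x)
    (fun x _ => by positivity) (tendsto_mul_inv_sqrt.sub ((tendsto_mul_inv_sqrt.pow 3).div_const 3))

lemma integral_inv_sqrt_pow_five :
    ∫ l in Set.Ioi (0 : ℝ), (√(1 + l ^ 2))⁻¹ ^ 5 = 2 / 3 := by
  rw [integral_Ioi_of_hasDerivAt_of_nonneg' (fun x _ => hasDerivAt_cube_sub x)
    (fun x _ => by positivity) (tendsto_mul_inv_sqrt.sub ((tendsto_mul_inv_sqrt.pow 3).div_const 3))]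
  norm_num

lemma integral_mul_inv_sqrt_pow_five :
    ∫ l in Set.Ioi (0 : ℝ), l * (√(1 + l ^ 2))⁻¹ ^ 5 = 1 / 3 := by
  have hd : ∀ x ∈ Set.Ici (0 : ℝ), HasDerivAt (fun l : ℝ => -((√(1 + l ^ 2))⁻¹ ^ 3 / 3))
      (x * (√(1 + x ^ 2))⁻¹ ^ 5) x := fun x _ => by
    refine (((hasDerivAt_inv_sqrt x).pow 3).div_const 3).neg.congr_deriv ?_
    push_cast
    ring
  have ht : Filter.Tendsto (fun l : ℝ => -((√(1 + l ^ 2))⁻¹ ^ 3 / 3)) Filter.atTop (nhds 0) := by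
    simpa using ((tendsto_inv_sqrt.pow 3).div_const 3).neg
  rw [integral_Ioi_of_hasDerivAt_of_nonneg' hd
    (fun x hx => mul_nonneg (Set.mem_Ioi.1 hx).le (by positivity)) ht]
  norm_num

/-- The same substitution gives `cos² φ`, with antiderivative `(φ + sin φ cos φ) / 2`. -/
lemma hasDerivAt_arctan_add (x : ℝ) :
    HasDerivAt (fun l : ℝ => (Real.arctan l + l * (1 + l ^ 2)⁻¹) / 2) (((1 + x ^ 2)⁻¹) ^ 2) x := by
  have h0 : (0 : ℝ) < 1 + x ^ 2 := by positivity
  have h1 : HasDerivAt (fun l : ℝ => 1 + l ^ 2) (2 * x) x := by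
    simpa using (hasDerivAt_pow 2 x).const_add 1
  have h2 := ((Real.hasDerivAt_arctan x).add
    ((hasDerivAt_id x).mul (h1.inv h0.ne'))).div_const 2
  refine h2.congr_deriv ?_
  simp only [id, Pi.inv_apply]
  field_simp
  ring

lemma tendsto_arctan_add : Filter.Tendsto
    (fun l : ℝ => (Real.arctan l + l * (1 + l ^ 2)⁻¹) / 2) Filter.atTop
      (nhds (Real.pi / 4)) := by
  have h1 : Filter.Tendsto Real.arctan Filter.atTop (nhds (Real.pi / 2)) :=
    Real.tendsto_arctan_atTop.mono_right nhdsWithin_le_nhds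
  have h2 : Filter.Tendsto (fun l : ℝ => l * (1 + l ^ 2)⁻¹) Filter.atTop (nhds 0) := by
    have := tendsto_mul_inv_sqrt.mul tendsto_inv_sqrt
    rw [mul_zero] at this
    refine this.congr fun l => ?_
    have h0 : (0 : ℝ) < 1 + l ^ 2 := by positivity
    rw [mul_assoc, ← mul_inv, Real.mul_self_sqrt h0.le]
  have := (h1.add h2).div_const 2
  convert this using 2
  ring

lemma integrableOn_inv_sq :
    IntegrableOn (fun l : ℝ => ((1 + l ^ 2)⁻¹) ^ 2) (Set.Ioi 0) :=
  integrableOn_Ioi_deriv_of_nonneg' (fun x _ => hasDerivAt_arctan_add x)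
    (fun x _ => by positivity) tendsto_arctan_add

lemma integral_inv_sq :
    ∫ l in Set.Ioi (0 : ℝ), ((1 + l ^ 2)⁻¹) ^ 2 = Real.pi / 4 := by
  rw [integral_Ioi_of_hasDerivAt_of_nonneg' (fun x _ => hasDerivAt_arctan_add x)
    (fun x _ => by positivity) tendsto_arctan_add]
  simp

/-- This and `integral_exp_neg_sq` supply the superpositions for `G⁻¹` and `G^(-1/2)` that are fed
to `integral_mul_radial`. -/
lemma integral_mul_exp_neg_sq {G : ℝ} (hG : 0 < G) :
    IntegrableOn (fun l : ℝ => l * Real.exp (-(l ^ 2 * G / 2))) (Set.Ioi 0) ∧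
    ∫ l in Set.Ioi (0 : ℝ), l * Real.exp (-(l ^ 2 * G / 2)) = G⁻¹ := by
  have hd : ∀ x ∈ Set.Ici (0 : ℝ), HasDerivAt (fun l : ℝ => -(G⁻¹ * Real.exp (-(l ^ 2 * G / 2))))
      (x * Real.exp (-(x ^ 2 * G / 2))) x := fun x _ => by
    have h1 : HasDerivAt (fun l : ℝ => -(l ^ 2 * G / 2)) (-(x * G)) x := by
      exact (((hasDerivAt_pow 2 x).mul_const G).div_const 2).neg.congr_deriv
        (by push_cast; ring)
    refine (h1.exp.const_mul G⁻¹).neg.congr_deriv ?_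
    field_simp
  have ht : Filter.Tendsto (fun l : ℝ => -(G⁻¹ * Real.exp (-(l ^ 2 * G / 2))))
      Filter.atTop (nhds 0) := by
    have : Filter.Tendsto (fun l : ℝ => -(l ^ 2 * G / 2)) Filter.atTop Filter.atBot := by
      refine Filter.tendsto_neg_atTop_atBot.comp ?_
      exact ((Filter.tendsto_pow_atTop two_ne_zero).atTop_mul_const hG).atTop_div_const
        (by norm_num)
    simpa using ((Real.tendsto_exp_atBot.comp this).const_mul G⁻¹).neg
  have hn : ∀ x ∈ Set.Ioi (0 : ℝ), 0 ≤ x * Real.exp (-(x ^ 2 * G / 2)) :=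
    fun x hx => mul_nonneg (Set.mem_Ioi.1 hx).le (Real.exp_pos _).le
  refine ⟨integrableOn_Ioi_deriv_of_nonneg' hd hn ht, ?_⟩
  rw [integral_Ioi_of_hasDerivAt_of_nonneg' hd hn ht]
  simp

lemma integral_exp_neg_sq {G : ℝ} (hG : 0 < G) :
    IntegrableOn (fun l : ℝ => √(2 / Real.pi) * Real.exp (-(l ^ 2 * G / 2))) (Set.Ioi 0) ∧
    ∫ l in Set.Ioi (0 : ℝ), √(2 / Real.pi) * Real.exp (-(l ^ 2 * G / 2)) = (√G)⁻¹ := by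
  have h : ∀ l : ℝ, Real.exp (-(l ^ 2 * G / 2)) = Real.exp (-(G / 2) * l ^ 2) := fun l => by
    congr 1; ring
  simp_rw [h]
  refine ⟨((integrable_exp_neg_mul_sq (half_pos hG)).integrableOn).const_mul _, ?_⟩
  rw [integral_const_mul, integral_gaussian_Ioi]
  have h1 : Real.pi / (G / 2) = (2 / Real.pi)⁻¹ * 4 * G⁻¹ * 1 := by
    have := Real.pi_pos
    field_simp
    norm_num
  have h2 : √(4 : ℝ) = 2 := by
    rw [show (4 : ℝ) = 2 ^ 2 by norm_num]; exact Real.sqrt_sq (by norm_num)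
  have h3 : 0 < √(2 / Real.pi) := Real.sqrt_pos.2 (by positivity)
  rw [h1, mul_one, Real.sqrt_mul (by positivity), Real.sqrt_mul (by positivity), h2,
    Real.sqrt_inv, Real.sqrt_inv]
  field_simp

end RadialIntegrals

/-! ### Moments of the direction of a projected Gaussian -/

section RatioMoments

variable {F : Type*} [NormedAddCommGroup F] [InnerProductSpace ℝ F] [FiniteDimensional ℝ F]
  [MeasurableSpace F] [BorelSpace F]

lemma ae_projSq_pos {x : Fin 3 → F} (hx : Orthonormal ℝ x) :
    ∀ᵐ r ∂stdGaussian F, 0 < projSq x r := by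
  filter_upwards [ae_inner_ne_zero (hx.ne_zero 0)] with r hr
  exact lt_of_lt_of_le (by positivity) (inner_sq_le_projSq x r 0)

/-- Superposition of Gaussian weights: exchanging the expectation with a radial integral. -/
lemma integral_mul_radial {x : Fin 3 → F} (hx : Orthonormal ℝ x) {N : F → ℝ} (hN : Measurable N)
    {ψ Ψ : ℝ → ℝ} (hψ : Measurable ψ) (hψ0 : ∀ l, 0 < l → 0 ≤ ψ l)
    (hΨ : ∀ G, 0 < G → IntegrableOn (fun l => ψ l * Real.exp (-(l ^ 2 * G / 2))) (Set.Ioi 0) ∧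
      ∫ l in Set.Ioi (0 : ℝ), ψ l * Real.exp (-(l ^ 2 * G / 2)) = Ψ G)
    (hint : Integrable (fun r => N r * Ψ (projSq x r)) (stdGaussian F)) :
    ∫ r, N r * Ψ (projSq x r) ∂stdGaussian F =
      ∫ l in Set.Ioi (0 : ℝ),
        ψ l * ∫ r, Real.exp (-(l ^ 2 * projSq x r / 2)) * N r ∂stdGaussian F := by
  let f : F → ℝ → ℝ := fun r l => N r * (ψ l * Real.exp (-(l ^ 2 * projSq x r / 2)))
  have hfm : Measurable (Function.uncurry f) := by
    have := measurable_projSq x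
    simp only [f, Function.uncurry_def]
    fun_prop
  have hae := ae_projSq_pos hx
  -- Because `ψ ≥ 0`, integrating `‖f r l‖` over `l` returns `‖N r * Ψ (projSq x r)‖`, so `hint` is
  -- exactly the integrability that Fubini requires.
  have hnorm : ∀ r, 0 < projSq x r →
      ∫ l in Set.Ioi (0 : ℝ), ‖f r l‖ = ‖N r * Ψ (projSq x r)‖ := by
    intro r hr
    have hpos : ∀ l ∈ Set.Ioi (0 : ℝ), 0 ≤ ψ l * Real.exp (-(l ^ 2 * projSq x r / 2)) :=
      fun l hl => mul_nonneg (hψ0 l hl) (Real.exp_pos _).le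
    have h0 : 0 ≤ Ψ (projSq x r) := by
      rw [← (hΨ _ hr).2]
      exact setIntegral_nonneg measurableSet_Ioi hpos
    rw [norm_mul, Real.norm_of_nonneg h0, ← (hΨ _ hr).2, ← integral_const_mul]
    refine setIntegral_congr_fun measurableSet_Ioi fun l hl => ?_
    simp only [f]
    rw [norm_mul, Real.norm_of_nonneg (hpos l hl)]
  have hprod : Integrable (Function.uncurry f)
      ((stdGaussian F).prod (volume.restrict (Set.Ioi (0 : ℝ)))) := by
    rw [integrable_prod_iff hfm.aestronglyMeasurable]
    constructor
    · filter_upwards [hae] with r hr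
      exact ((hΨ _ hr).1).const_mul (N r)
    · refine hint.norm.congr ?_
      filter_upwards [hae] with r hr
      exact (hnorm r hr).symm
  have hswap := integral_integral_swap hprod
  have h1 : ∫ r, N r * Ψ (projSq x r) ∂stdGaussian F =
      ∫ r, (∫ l in Set.Ioi (0 : ℝ), f r l) ∂stdGaussian F := by
    refine integral_congr_ae ?_
    filter_upwards [hae] with r hr
    simp only [f]
    rw [integral_const_mul, (hΨ _ hr).2]
  rw [h1, hswap]
  refine integral_congr_ae (Filter.Eventually.of_forall fun l => ?_)
  simp only [f]
  rw [← integral_const_mul]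
  refine integral_congr_ae (Filter.Eventually.of_forall fun r => ?_)
  ring

lemma measurable_ratio (x : Fin 3 → F) (a : Fin 3) :
    Measurable fun r => ⟪x a, r⟫ / √(projSq x r) := by
  have := measurable_projSq x
  fun_prop

lemma integrable_ratio_mul {x : Fin 3 → F} (a : Fin 3) {f : F → ℝ}
    (hf : Integrable f (stdGaussian F)) :
    Integrable (fun r => ⟪x a, r⟫ / √(projSq x r) * f r) (stdGaussian F) :=
  hf.bdd_mul (c := 1) (measurable_ratio x a).aestronglyMeasurable
    (Filter.Eventually.of_forall fun r => abs_inner_div_sqrt_projSq_le x r a)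

lemma integrable_ratio (x : Fin 3 → F) (a : Fin 3) :
    Integrable (fun r => ⟪x a, r⟫ / √(projSq x r)) (stdGaussian F) := by
  simpa using integrable_ratio_mul (x := x) a (integrable_const (1 : ℝ))

/-- With `κ = (√(1 + l²))⁻¹`, the determinant gives `κ³`, and moving the rescaling onto `x a` from
both factors gives `κ²`. -/
lemma integral_exp_mul_inner_mul_inner {x : Fin 3 → F} (hx : Orthonormal ℝ x) (a : Fin 3)
    (y : F) (l : ℝ) :
    ∫ r, Real.exp (-(l ^ 2 * projSq x r / 2)) * (⟪x a, r⟫ * ⟪y, r⟫) ∂stdGaussian F =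
      (√(1 + l ^ 2))⁻¹ ^ 5 * ⟪x a, y⟫ := by
  obtain ⟨S, -, hS1, hS2, -, hS4⟩ := exists_rescaling hx (sq_nonneg l)
  rw [hS4 (fun r => ⟪x a, r⟫ * ⟪y, r⟫) (by fun_prop)]
  simp_rw [hS1]
  rw [integral_inner_mul_inner_stdGaussian, hS2, real_inner_smul_left, hS1, hS2,
    real_inner_smul_left]
  ring

lemma integral_ratio_mul_inner {x : Fin 3 → F} (hx : Orthonormal ℝ x) (a : Fin 3) (y : F) :
    ∫ r, ⟪x a, r⟫ / √(projSq x r) * ⟪y, r⟫ ∂stdGaussian F =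
      2 / 3 * √(2 / Real.pi) * ⟪x a, y⟫ := by
  have h := integral_mul_radial hx (N := fun r => ⟪x a, r⟫ * ⟪y, r⟫) (by fun_prop)
    (ψ := fun _ => √(2 / Real.pi)) (Ψ := fun G => (√G)⁻¹) measurable_const
    (fun _ _ => Real.sqrt_nonneg _) (fun G hG => integral_exp_neg_sq hG)
    ((integrable_ratio_mul (x := x) a (integrable_inner_stdGaussian y)).congr
      (Filter.Eventually.of_forall fun r => by simp only [div_eq_mul_inv]; ring))
  simp_rw [integral_exp_mul_inner_mul_inner hx] at h
  rw [integral_const_mul, integral_mul_const, integral_inv_sqrt_pow_five] at h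
  calc _ = _ := integral_congr_ae (Filter.Eventually.of_forall fun r => by
        simp only [div_eq_mul_inv]; ring)
    _ = _ := h
    _ = _ := by ring

lemma integral_ratio_mul_ratio {x : Fin 3 → F} (hx : Orthonormal ℝ x) (a b : Fin 3) :
    ∫ r, ⟪x a, r⟫ / √(projSq x r) * (⟪x b, r⟫ / √(projSq x r)) ∂stdGaussian F =
      if a = b then 1 / 3 else 0 := by
  have hr : ∀ r, ⟪x a, r⟫ / √(projSq x r) * (⟪x b, r⟫ / √(projSq x r)) =
      ⟪x a, r⟫ * ⟪x b, r⟫ * (projSq x r)⁻¹ := fun r => by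
    rw [div_mul_div_comm, Real.mul_self_sqrt (projSq_nonneg x r), div_eq_mul_inv]
  have h := integral_mul_radial hx (N := fun r => ⟪x a, r⟫ * ⟪x b, r⟫) (by fun_prop)
    (ψ := fun l => l) (Ψ := fun G => G⁻¹) measurable_id
    (fun _ h => h.le) (fun G hG => integral_mul_exp_neg_sq hG)
    ((integrable_ratio_mul (x := x) a (integrable_ratio x b)).congr
      (Filter.Eventually.of_forall hr))
  simp_rw [integral_exp_mul_inner_mul_inner hx, ← mul_assoc] at h
  rw [integral_mul_const, integral_mul_inv_sqrt_pow_five] at h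
  simp_rw [hr]
  rw [h, orthonormal_iff_ite.1 hx]
  split_ifs <;> simp

/-- The rescaling changes the sign vector to `S v`, whose length enters through
`integral_sgn_mul_inner`. With `κ = (√(1 + l²))⁻¹`, the powers combine as `κ³ · κ² / κ = κ⁴`; what
remains of `‖S v‖` is the last root. -/
lemma integral_exp_mul_sgn_mul_inner {x : Fin 3 → F} (hx : Orthonormal ℝ x) {v : F}
    (hv : ‖v‖ = 1) (a : Fin 3) (l : ℝ) :
    ∫ r, Real.exp (-(l ^ 2 * projSq x r / 2)) * (sgn ⟪v, r⟫ * ⟪x a, r⟫) ∂stdGaussian F =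
      √(2 / Real.pi) * (((1 + l ^ 2)⁻¹) ^ 2 * (√(1 + l ^ 2 * (1 - projSq x v)))⁻¹) * ⟪x a, v⟫ := by
  obtain ⟨S, -, hS1, hS2, hS3, hS4⟩ := exists_rescaling hx (sq_nonneg l)
  have h0 : (0 : ℝ) < 1 + l ^ 2 := by positivity
  have hk := Real.sqrt_pos.2 h0
  have hv1 : projSq x v ≤ 1 := by simpa [hv] using projSq_le_norm_sq hx v
  have hsq : ‖S v‖ ^ 2 = (1 + l ^ 2)⁻¹ * (1 + l ^ 2 * (1 - projSq x v)) := by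
    rw [hS3, hv]; field_simp; ring
  have hpos : 0 < 1 + l ^ 2 * (1 - projSq x v) := by
    have : 0 ≤ 1 - projSq x v := by linarith
    positivity
  have hnorm : ‖S v‖ = (√(1 + l ^ 2))⁻¹ * √(1 + l ^ 2 * (1 - projSq x v)) := by
    rw [← Real.sqrt_inv, ← Real.sqrt_mul (by positivity), ← hsq, Real.sqrt_sq (norm_nonneg _)]
  have hSv : S v ≠ 0 := by
    rw [← norm_ne_zero_iff, hnorm]
    positivity
  rw [hS4 (fun r => sgn ⟪v, r⟫ * ⟪x a, r⟫)
    (by have := measurable_sgn; fun_prop)]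
  simp_rw [hS1]
  rw [integral_sgn_mul_inner hSv, hS2, inner_smul_right, ← hS1, hS2, inner_smul_right, hnorm,
    real_inner_comm v]
  have h1 := Real.sqrt_pos.2 hpos
  have h2 : (1 + l ^ 2)⁻¹ ^ 2 = (√(1 + l ^ 2))⁻¹ ^ 4 := by
    rw [show 4 = 2 * 2 from rfl, pow_mul (√(1 + l ^ 2))⁻¹, inv_pow (√(1 + l ^ 2)),
      Real.sq_sqrt h0.le]
  rw [h2]
  field_simp

/-- The sign-weighted mean of the direction of the projection of a Gaussian vector. -/
lemma exists_integral_sgn_mul_ratio {x : Fin 3 → F} (hx : Orthonormal ℝ x) {v : F}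
    (hv : ‖v‖ = 1) :
    ∃ c : ℝ, 4 / (3 * Real.pi) ≤ c ∧ c ≤ 1 / 2 ∧ ∀ a,
      ∫ r, sgn ⟪v, r⟫ * (⟪x a, r⟫ / √(projSq x r)) ∂stdGaussian F = c * ⟪x a, v⟫ := by
  have hv1 : projSq x v ≤ 1 := by simpa [hv] using projSq_le_norm_sq hx v
  have hv0 := projSq_nonneg x v
  -- Since `0 ≤ projSq x v ≤ 1`, the last factor lies between `(1 + l²)^(-1/2)` and `1`. These
  -- extremes integrate to the two bounds on `c`; they correspond to `v` orthogonal to the span of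
  -- `x` and to `v` inside it.
  let j : ℝ → ℝ := fun l => (1 + l ^ 2)⁻¹ ^ 2 * (√(1 + l ^ 2 * (1 - projSq x v)))⁻¹
  have hj1 : ∀ l, j l ≤ (1 + l ^ 2)⁻¹ ^ 2 := fun l => by
    refine mul_le_of_le_one_right (by positivity) (inv_le_one_of_one_le₀ ?_)
    rw [Real.one_le_sqrt]
    have : 0 ≤ l ^ 2 * (1 - projSq x v) := mul_nonneg (sq_nonneg l) (by linarith)
    linarith
  have hj0 : ∀ l, 0 ≤ j l := fun l => by positivity
  have hj2 : ∀ l, (√(1 + l ^ 2))⁻¹ ^ 5 ≤ j l := fun l => by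
    have h0 : (0 : ℝ) < 1 + l ^ 2 := by positivity
    have h2 : (√(1 + l ^ 2))⁻¹ ^ 5 = (1 + l ^ 2)⁻¹ ^ 2 * (√(1 + l ^ 2))⁻¹ := by
      rw [pow_succ, show 4 = 2 * 2 from rfl, pow_mul (√(1 + l ^ 2))⁻¹, inv_pow (√(1 + l ^ 2)),
        Real.sq_sqrt h0.le]
    rw [h2]
    refine mul_le_mul_of_nonneg_left ?_ (by positivity)
    have hp : 0 < 1 + l ^ 2 * (1 - projSq x v) := by
      have : 0 ≤ l ^ 2 * (1 - projSq x v) := mul_nonneg (sq_nonneg l) (by linarith)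
      linarith
    refine inv_anti₀ (Real.sqrt_pos.2 hp) (Real.sqrt_le_sqrt ?_)
    nlinarith [sq_nonneg l]
  have hjm : Measurable j := by
    have : Measurable fun l : ℝ => √(1 + l ^ 2 * (1 - projSq x v)) := by fun_prop
    simp only [j]
    fun_prop
  have hji : IntegrableOn j (Set.Ioi 0) :=
    integrableOn_inv_sq.mono' hjm.aestronglyMeasurable
      (Filter.Eventually.of_forall fun l => by rw [Real.norm_of_nonneg (hj0 l)]; exact hj1 l)
  have hlow := integral_mono integrableOn_inv_sqrt_pow_five hji hj2
  have hup := integral_mono hji integrableOn_inv_sq hj1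
  rw [integral_inv_sqrt_pow_five] at hlow
  rw [integral_inv_sq] at hup
  have hpi := Real.pi_pos
  refine ⟨2 / Real.pi * ∫ l in Set.Ioi (0 : ℝ), j l, ?_, ?_, fun a => ?_⟩
  · calc 4 / (3 * Real.pi) = 2 / Real.pi * (2 / 3) := by field_simp; norm_num
      _ ≤ _ := mul_le_mul_of_nonneg_left hlow (by positivity)
  · calc _ ≤ 2 / Real.pi * (Real.pi / 4) := mul_le_mul_of_nonneg_left hup (by positivity)
      _ = 1 / 2 := by field_simp; norm_num
  · have hr : ∀ r, sgn ⟪v, r⟫ * (⟪x a, r⟫ / √(projSq x r)) =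
        sgn ⟪v, r⟫ * ⟪x a, r⟫ * (√(projSq x r))⁻¹ := fun r => by
      rw [div_eq_mul_inv, mul_assoc]
    have hm : Measurable fun r => sgn ⟪v, r⟫ := measurable_sgn.comp (by fun_prop)
    have h := integral_mul_radial hx (N := fun r => sgn ⟪v, r⟫ * ⟪x a, r⟫)
      (by fun_prop)
      (ψ := fun _ => √(2 / Real.pi)) (Ψ := fun G => (√G)⁻¹) measurable_const
      (fun _ _ => Real.sqrt_nonneg _) (fun G hG => integral_exp_neg_sq hG)
      (((integrable_ratio x a).bdd_mul (c := 1) hm.aestronglyMeasurable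
        (Filter.Eventually.of_forall fun r => by rw [Real.norm_eq_abs, abs_sgn])).congr
        (Filter.Eventually.of_forall hr))
    simp_rw [integral_exp_mul_sgn_mul_inner hx hv] at h
    rw [integral_const_mul, integral_mul_const, integral_const_mul] at h
    simp_rw [hr]
    rw [h, ← mul_assoc, ← mul_assoc, Real.mul_self_sqrt (by positivity)]

end RatioMoments

/-! ### Residuals and the correlation bound -/

section Residual

variable {F : Type*} [NormedAddCommGroup F] [InnerProductSpace ℝ F] [FiniteDimensional ℝ F]
  [MeasurableSpace F] [BorelSpace F]

/-- The part of the normalized coordinate that is orthogonal to all linear functions. -/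
noncomputable def resid (x : Fin 3 → F) (a : Fin 3) (r : F) : ℝ :=
  ⟪x a, r⟫ / √(projSq x r) - 2 / 3 * √(2 / Real.pi) * ⟪x a, r⟫

lemma memLp_resid (x : Fin 3 → F) (a : Fin 3) : MemLp (resid x a) 2 (stdGaussian F) := by
  refine MemLp.sub ?_ ((memLp_inner_stdGaussian (x a)).const_mul _)
  exact MemLp.of_bound (measurable_ratio x a).aestronglyMeasurable 1
    (Filter.Eventually.of_forall fun r => abs_inner_div_sqrt_projSq_le x r a)

lemma integrable_resid_mul_resid (x y : Fin 3 → F) (a b : Fin 3) :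
    Integrable (fun r => resid x a r * resid y b r) (stdGaussian F) :=
  (memLp_resid x a).integrable_mul (memLp_resid y b)

lemma two_thirds_sqrt_sq : (2 / 3 * √(2 / Real.pi)) ^ 2 = 8 / (9 * Real.pi) := by
  have := Real.pi_pos
  rw [mul_pow, Real.sq_sqrt (by positivity)]
  field_simp
  norm_num

/-- On expansion, the two mixed terms and the product of linear parts each have the value `8/(9π) ⟪x
a, y b⟫`, with signs `-`, `-`, `+`. -/
lemma integral_resid_mul_resid {x y : Fin 3 → F} (hx : Orthonormal ℝ x) (hy : Orthonormal ℝ y)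
    (a b : Fin 3) :
    ∫ r, resid x a r * resid y b r ∂stdGaussian F =
      ∫ r, ⟪x a, r⟫ / √(projSq x r) * (⟪y b, r⟫ / √(projSq y r)) ∂stdGaussian F -
        8 / (9 * Real.pi) * ⟪x a, y b⟫ := by
  set c := 2 / 3 * √(2 / Real.pi) with hc
  have h1 := integrable_ratio_mul (x := x) a (integrable_ratio y b)
  have h2 := (integrable_ratio_mul (x := x) a (integrable_inner_stdGaussian (y b))).const_mul c
  have h3 := (integrable_ratio_mul (x := y) b (integrable_inner_stdGaussian (x a))).const_mul c
  have h4 : Integrable (fun r => c ^ 2 * (⟪x a, r⟫ * ⟪y b, r⟫)) (stdGaussian F) :=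
    ((memLp_inner_stdGaussian (x a)).integrable_mul
      (memLp_inner_stdGaussian (y b))).const_mul (c ^ 2)
  have h12 : Integrable (fun r => ⟪x a, r⟫ / √(projSq x r) * (⟪y b, r⟫ / √(projSq y r)) -
      c * (⟪x a, r⟫ / √(projSq x r) * ⟪y b, r⟫)) (stdGaussian F) := h1.sub h2
  have h123 : Integrable (fun r => ⟪x a, r⟫ / √(projSq x r) * (⟪y b, r⟫ / √(projSq y r)) -
      c * (⟪x a, r⟫ / √(projSq x r) * ⟪y b, r⟫) -
      c * (⟪y b, r⟫ / √(projSq y r) * ⟪x a, r⟫)) (stdGaussian F) := h12.sub h3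
  have he : ∀ r, resid x a r * resid y b r =
      ⟪x a, r⟫ / √(projSq x r) * (⟪y b, r⟫ / √(projSq y r)) -
      c * (⟪x a, r⟫ / √(projSq x r) * ⟪y b, r⟫) - c * (⟪y b, r⟫ / √(projSq y r) * ⟪x a, r⟫) +
      c ^ 2 * (⟪x a, r⟫ * ⟪y b, r⟫) := fun r => by
    simp only [resid, ← hc]; ring
  simp_rw [he]
  rw [integral_add h123 h4, integral_sub h12 h3, integral_sub h1 h2,
    integral_const_mul, integral_const_mul, integral_const_mul, integral_ratio_mul_inner hx,
    integral_ratio_mul_inner hy, integral_inner_mul_inner_stdGaussian, real_inner_comm (x a),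
    ← two_thirds_sqrt_sq, ← hc]
  ring

/-- A lower bound for the correlations of two normalized Gaussian vectors, by their linear part. -/
lemma sum_integral_ratio_mul_ratio_ge {x y : Fin 3 → F} (hx : Orthonormal ℝ x)
    (hy : Orthonormal ℝ y) (t : Fin 3 → Fin 3 → ℝ) :
    8 / (9 * Real.pi) * ∑ a, ∑ b, t a b * ⟪x a, y b⟫ -
        (1 / 3 - 8 / (9 * Real.pi)) * (3 + ∑ a, ∑ b, t a b ^ 2) / 2 ≤
      ∑ a, ∑ b, t a b *
        ∫ r, ⟪x a, r⟫ / √(projSq x r) * (⟪y b, r⟫ / √(projSq y r)) ∂stdGaussian F := by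
  have hself : ∀ {z : Fin 3 → F}, Orthonormal ℝ z → ∀ a b,
      ∫ r, resid z a r * resid z b r ∂stdGaussian F =
        if a = b then 1 / 3 - 8 / (9 * Real.pi) else 0 := fun {z} hz a b => by
    rw [integral_resid_mul_resid hz hz, integral_ratio_mul_ratio hz, orthonormal_iff_ite.1 hz]
    split_ifs <;> simp
  -- This is the expansion of `E (resid y b + ∑ a, t a b * resid x a)² ≥ 0`. The unknown cross
  -- correlations enter linearly and the rest is known from `hself`; summing over `b` bounds them as
  -- wanted.
  have hb : ∀ b, 0 ≤ (1 / 3 - 8 / (9 * Real.pi)) +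
      2 * ∑ a, t a b * ∫ r, resid x a r * resid y b r ∂stdGaussian F +
      (1 / 3 - 8 / (9 * Real.pi)) * ∑ a, t a b ^ 2 := fun b => by
    have h0 : 0 ≤ ∫ r, (resid y b r + ∑ a, t a b * resid x a r) ^ 2 ∂stdGaussian F :=
      integral_nonneg fun r => sq_nonneg _
    have he : ∀ r, (resid y b r + ∑ a, t a b * resid x a r) ^ 2 =
        resid y b r * resid y b r + 2 * ∑ a, t a b * (resid x a r * resid y b r) +
        ∑ a, ∑ a', t a b * t a' b * (resid x a r * resid x a' r) := fun r => by
      have e1 : ∑ a, ∑ a', t a b * t a' b * (resid x a r * resid x a' r) =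
          (∑ a, t a b * resid x a r) * ∑ a, t a b * resid x a r := by
        rw [Finset.sum_mul_sum]
        exact Finset.sum_congr rfl fun a _ => Finset.sum_congr rfl fun a' _ => by ring
      have e2 : ∑ a, t a b * (resid x a r * resid y b r) =
          (∑ a, t a b * resid x a r) * resid y b r := by
        rw [Finset.sum_mul]; exact Finset.sum_congr rfl fun a _ => by ring
      rw [e1, e2]; ring
    have i1 := integrable_resid_mul_resid y y b b
    have i2 : ∀ a ∈ Finset.univ, Integrable (fun r => t a b * (resid x a r * resid y b r))
      (stdGaussian F) := fun a _ => (integrable_resid_mul_resid x y a b).const_mul _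
    have i3 : ∀ a ∈ Finset.univ, ∀ a' ∈ Finset.univ, Integrable
      (fun r => t a b * t a' b * (resid x a r * resid x a' r)) (stdGaussian F) :=
      fun a _ a' _ => (integrable_resid_mul_resid x x a a').const_mul _
    have i12 : Integrable (fun r => resid y b r * resid y b r +
        2 * ∑ a, t a b * (resid x a r * resid y b r)) (stdGaussian F) :=
      i1.add ((integrable_finsetSum _ i2).const_mul 2)
    simp_rw [he] at h0
    rw [integral_add i12
      (integrable_finsetSum _ fun a ha => integrable_finsetSum _ (i3 a ha)),
      integral_add i1 ((integrable_finsetSum _ i2).const_mul 2), integral_const_mul,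
      integral_finsetSum _ i2,
      integral_finsetSum _ fun a ha => integrable_finsetSum _ (i3 a ha)] at h0
    simp_rw [fun a => integral_finsetSum Finset.univ (i3 a (Finset.mem_univ a)),
      integral_const_mul, hself hx, hself hy] at h0
    have e3 : ∑ a, ∑ a', t a b * t a' b * (if a = a' then 1 / 3 - 8 / (9 * Real.pi) else 0) =
        (1 / 3 - 8 / (9 * Real.pi)) * ∑ a, t a b ^ 2 := by
      rw [Finset.mul_sum]
      refine Finset.sum_congr rfl fun a _ => ?_
      rw [Finset.sum_eq_single a]
      · simp; ring
      · intro a' _ h; rw [if_neg h.symm, mul_zero]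
      · simp
    rw [e3] at h0
    simpa using h0
  have hsum := Finset.sum_nonneg fun b (_ : b ∈ Finset.univ) => hb b
  rw [Finset.sum_add_distrib, Finset.sum_add_distrib, ← Finset.mul_sum, ← Finset.mul_sum,
    Finset.sum_comm, Finset.sum_comm (f := fun b a => t a b ^ 2)] at hsum
  simp_rw [integral_resid_mul_resid hx hy, mul_sub, Finset.sum_sub_distrib] at hsum
  have e4 : ∑ a, ∑ b, t a b * (8 / (9 * Real.pi) * ⟪x a, y b⟫) =
      8 / (9 * Real.pi) * ∑ a, ∑ b, t a b * ⟪x a, y b⟫ := by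
    simp_rw [Finset.mul_sum]
    exact Finset.sum_congr rfl fun a _ => Finset.sum_congr rfl fun b _ => by ring
  rw [e4] at hsum
  simp at hsum ⊢
  linarith

end Residual

/-! ### The ratios and the scalar inequality -/

lemma inv_pi_bounds : 0.318 < Real.pi⁻¹ ∧ Real.pi⁻¹ < 0.3185 := by
  have h1 := Real.pi_gt_d4
  have h2 := Real.pi_lt_d4
  have h3 := Real.pi_pos
  constructor
  · rw [lt_inv_comm₀ (by norm_num) h3]; norm_num; linarith
  · rw [inv_lt_comm₀ h3 (by norm_num)]; norm_num; linarith

lemma alpha_one : alpha 1 = 2 * Real.pi⁻¹ - 1 / 4 := by simp [alpha]; ring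

lemma alpha_two : alpha 2 = 16 / 9 * Real.pi⁻¹ := by simp [alpha]; ring

lemma alpha_three : alpha 3 = 3 / 8 + 11 / 9 * Real.pi⁻¹ := by simp [alpha]; ring

lemma alpha_mono {k l : ℕ} (hk : k = 1 ∨ k = 2 ∨ k = 3) (hl : l = 1 ∨ l = 2 ∨ l = 3)
    (h : k ≤ l) : alpha k ≤ alpha l := by
  obtain ⟨h1, h2⟩ := inv_pi_bounds
  rcases hk with rfl | rfl | rfl <;> rcases hl with rfl | rfl | rfl <;>
    first
    | omega
    | (simp only [alpha_one, alpha_two, alpha_three]; linarith)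

lemma alpha_pos {k : ℕ} (hk : k = 1 ∨ k = 2 ∨ k = 3) : 0 < alpha k := by
  refine lt_of_lt_of_le ?_ (alpha_mono (Or.inl rfl) hk (by omega))
  obtain ⟨h1, h2⟩ := inv_pi_bounds
  rw [alpha_one]
  linarith

/-- The scalar inequality behind the approximation ratio: `K` is the rank of the projector,
`p`, `q` are the contributions of its local Pauli terms and `T` is that of its two-qubit Pauli
terms, `np`, `nq`, `nT` are the squared lengths of the corresponding coefficient vectors. -/
lemma ratio_inequality {k K : ℕ} (hk : k = 1 ∨ k = 2 ∨ k = 3) (hkK : k ≤ K) (hK : K ≤ 4)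
    {p q T np nq nT c c' : ℝ} (hp : p ^ 2 ≤ np) (hq : q ^ 2 ≤ nq)
    (hn : np + nq + nT = K * (4 - K))
    (h1 : 0 ≤ K + (p + q) + T) (h2 : 0 ≤ K - (p + q) + T)
    (h3 : K + (p + q) + T ≤ 4) (h4 : K - (p + q) + T ≤ 4)
    (hc : 4 / (3 * Real.pi) ≤ c) (hc2 : c ≤ 1 / 2)
    (hc' : 4 / (3 * Real.pi) ≤ c') (hc2' : c' ≤ 1 / 2) :
    alpha k * (K + (p + q) + T) ≤
      K + c * p + c' * q +
        (8 / (9 * Real.pi) * T - (1 / 3 - 8 / (9 * Real.pi)) * (3 + nT) / 2) := by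
  obtain ⟨b1, b2⟩ := inv_pi_bounds
  have e4 : 4 / (3 * Real.pi) = 4 / 3 * Real.pi⁻¹ := by ring
  have e5 : 8 / (9 * Real.pi) = 8 / 9 * Real.pi⁻¹ := by ring
  rw [e4] at hc hc'
  rw [e5]
  have a1 := alpha_one
  have a2 := alpha_two
  have a3 := alpha_three
  -- The ratios increase with the rank and the value is nonnegative, so rank `K` may be treated with
  -- `alpha K`, and rank `4` with `alpha 3`.
  have hmono : ∀ l, l = 1 ∨ l = 2 ∨ l = 3 → k ≤ l →
      alpha k * (K + (p + q) + T) ≤ alpha l * (K + (p + q) + T) :=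
    fun l hl hkl => mul_le_mul_of_nonneg_right (alpha_mono hk hl hkl) h1
  set w := Real.pi⁻¹
  have hε : 0 < 1 / 3 - 8 / 9 * w := by linarith
  have hloc0 : ∀ {s u : ℝ}, 4 / 3 * w ≤ s → 0 ≤ u → 4 / 3 * w * u ≤ s * u :=
    fun hs hu => mul_le_mul_of_nonneg_right hs hu
  have hloc1 : ∀ {s u : ℝ}, s ≤ 1 / 2 → u ≤ 0 → 1 / 2 * u ≤ s * u :=
    fun hs hu => mul_le_mul_of_nonpos_right hs hu
  -- For negative `u` only `s ≤ 1/2` helps. The gap `1/2 - 4w/3` equals `3ε/2` with `ε = 1/3 -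
  -- 8w/9`, so the square `(u + 3/2)²` absorbs it. The loss `εm/2` is repaid later, since `np` and
  -- `nq` reduce `nT`.
  have hloc : ∀ {s u m : ℝ}, 4 / 3 * w ≤ s → s ≤ 1 / 2 → u ^ 2 ≤ m →
      4 / 3 * w * u - (1 / 3 - 8 / 9 * w) * (m + 9 / 4) / 2 ≤ s * u := by
    intro s u m hs hs2 hm
    have hm0 : 0 ≤ (1 / 3 - 8 / 9 * w) * (m - u ^ 2) := mul_nonneg hε.le (by linarith)
    rcases le_total 0 u with hu | hu
    · have := hloc0 hs hu
      have : 0 ≤ (1 / 3 - 8 / 9 * w) * (m + 9 / 4) := mul_nonneg hε.le (by nlinarith)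
      linarith
    · have h5 := hloc1 hs2 hu
      have h6 : 0 ≤ (1 / 3 - 8 / 9 * w) * (u + 3 / 2) ^ 2 := mul_nonneg hε.le (sq_nonneg _)
      linarith
  have hlp := hloc hc hc2 hp
  have hlq := hloc hc' hc2' hq
  have hnp : 0 ≤ np := (sq_nonneg p).trans hp
  have hnq : 0 ≤ nq := (sq_nonneg q).trans hq
  have hnp' := mul_nonneg hε.le hnp
  have hnq' := mul_nonneg hε.le hnq
  have hKcases : K = 1 ∨ K = 2 ∨ K = 3 ∨ K = 4 := by omega
  rcases hKcases with rfl | rfl | rfl | rfl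
  · refine (hmono 1 (by simp) hkK).trans ?_
    rw [a1]
    norm_num at hn h1 h2 h3 h4 ⊢
    have hT : T ≤ 3 := by linarith only [h3, h4]
    have n := congrArg (fun z => (1 / 3 - 8 / 9 * w) * z) hn
    beta_reduce at n
    clear hloc hloc0 hloc1 hmono a1 a2 a3 e4 e5
    -- At rank one the coefficient of `p + q` left over is positive, so the spin-flipped bound `h4`
    -- is the one needed; the higher ranks use `h3`.
    have m1 : 0 ≤ (1 / 4 - 2 / 3 * w) * (4 - (1 - (p + q) + T)) :=
      mul_nonneg (by linarith only [b1, b2]) (by linarith only [h3, h4, hT])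
    have m2 : 0 ≤ (16 / 9 * w - 1 / 2) * (3 - T) := mul_nonneg (by linarith only [b1, b2]) (by linarith only [h3, h4, hT])
    linarith
  · refine (hmono 2 (by simp) hkK).trans ?_
    rw [a2]
    norm_num at hn h1 h2 h3 h4 ⊢
    have hT : T ≤ 2 := by linarith only [h3, h4]
    have n := congrArg (fun z => (1 / 3 - 8 / 9 * w) * z) hn
    beta_reduce at n
    clear hloc hloc0 hloc1 hmono a1 a2 a3 e4 e5
    have m1 : 0 ≤ (4 / 9 * w) * (4 - (2 + (p + q) + T)) :=
      mul_nonneg (by linarith only [b1, b2]) (by linarith only [h3, h4, hT])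
    have m2 : 0 ≤ (4 / 9 * w) * (2 - T) := mul_nonneg (by linarith only [b1, b2]) (by linarith only [h3, h4, hT])
    linarith
  · refine (hmono 3 (by simp) hkK).trans ?_
    rw [a3]
    norm_num at hn h1 h2 h3 h4 ⊢
    have hT : T ≤ 1 := by linarith only [h3, h4]
    have n := congrArg (fun z => (1 / 3 - 8 / 9 * w) * z) hn
    beta_reduce at n
    have m1 : 0 ≤ (3 / 8 - 1 / 9 * w) * (4 - (3 + (p + q) + T)) :=
      mul_nonneg (by linarith only [b1, b2]) (by linarith only [h3, h4, hT])
    have m2 : 0 ≤ (4 / 9 * w) * (1 - T) := mul_nonneg (by linarith only [b1, b2]) (by linarith only [h3, h4, hT])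
    -- Using `hloc` for both local terms would lose `9ε/4` in constants, more than the slack `3ε/2`
    -- available at `p + q = 0`, `T = 1`. Hence it is used for at most one; if both are negative,
    -- the bound `1/2` is used directly.
    rcases le_total 0 p with hp0 | hp0
    · have := hloc0 hc hp0
      linarith
    rcases le_total 0 q with hq0 | hq0
    · have := hloc0 hc' hq0
      linarith
    have f1 := hloc1 hc2 hp0
    have f2 := hloc1 hc2' hq0
    have m3 : 0 ≤ (11 / 9 * w - 1 / 8) * (4 - (3 + (p + q) + T)) :=
      mul_nonneg (by linarith only [b1, b2]) (by linarith only [h3, h4, hT])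
    have m4 : 0 ≤ (1 / 2 - 8 / 9 * w) * (1 - T) := mul_nonneg (by linarith only [b1, b2]) (by linarith only [h3, h4, hT])
    linarith
  · refine (hmono 3 (by simp) (by omega)).trans ?_
    rw [a3]
    norm_num at hn h1 h2 h3 h4 ⊢
    have hT : T ≤ 0 := by linarith only [h3, h4]
    have n := congrArg (fun z => (1 / 3 - 8 / 9 * w) * z) hn
    beta_reduce at n
    have m1 : 0 ≤ (3 / 8 - 1 / 9 * w) * (4 - (4 + (p + q) + T)) :=
      mul_nonneg (by linarith only [b1, b2]) (by linarith only [h3, h4, hT])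
    have m2 : 0 ≤ (4 / 9 * w) * (0 - T) := mul_nonneg (by linarith only [b1, b2]) (by linarith only [h3, h4, hT])
    linarith

/-! ### Pauli expansions of two-qubit operators -/

section Pauli

lemma pauli_isHermitian (k : Fin 4) : (pauli k).IsHermitian := by
  ext a b
  fin_cases k <;> fin_cases a <;> fin_cases b <;> simp [pauli, Matrix.conjTranspose_apply]

/-- Completeness of the Pauli basis: `∑ σᵏ ⊗ σᵏ` is twice the swap operator. Applied to each factor,
it yields `pauli_expansion`. -/
lemma sum_pauli_mul_pauli (a b c d : Fin 2) :
    ∑ k, pauli k a b * pauli k c d = if a = d ∧ b = c then 2 else 0 := by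
  fin_cases a <;> fin_cases b <;> fin_cases c <;> fin_cases d <;>
    simp [pauli, Fin.sum_univ_four] <;> norm_num

lemma trace_pauli_mul_pauli (k l : Fin 4) :
    (pauli k * pauli l).trace = if k = l then 2 else 0 := by
  fin_cases k <;> fin_cases l <;>
    simp [pauli, Matrix.trace, Fin.sum_univ_two] <;> norm_num

lemma trace_pauli_succ (k : Fin 3) : (pauli k.succ).trace = 0 := by
  fin_cases k <;> simp [pauli, Matrix.trace, Fin.sum_univ_two]

lemma pauli_zero : pauli 0 = 1 := rfl

lemma pauli_mul_self (k : Fin 4) : pauli k * pauli k = 1 := by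
  ext a b
  fin_cases k <;> fin_cases a <;> fin_cases b <;>
    simp [pauli]

lemma pauli_anticomm {k l : Fin 3} (h : k ≠ l) :
    pauli k.succ * pauli l.succ + pauli l.succ * pauli k.succ = 0 := by
  ext a b
  fin_cases k <;> fin_cases l <;> first
    | exact absurd rfl h
    | (fin_cases a <;> fin_cases b <;> simp [pauli])

/-- Expansion of a two-qubit operator in the Pauli basis. -/
lemma pauli_expansion (X : TwoQubitOp) :
    X = (1 / 4 : ℂ) • ∑ k, ∑ l,
      ((pauli k ⊗ₖ pauli l) * X).trace • (pauli k ⊗ₖ pauli l) := by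
  ext ⟨a, b⟩ ⟨c, d⟩
  have h : ∀ k l, ((pauli k ⊗ₖ pauli l) * X).trace =
      ∑ s : Fin 2 × Fin 2, ∑ t : Fin 2 × Fin 2,
        pauli k s.1 t.1 * pauli l s.2 t.2 * X t s := fun k l => by
    simp [Matrix.trace, Matrix.mul_apply, Matrix.kroneckerMap_apply]
  simp only [Matrix.smul_apply, Matrix.sum_apply, h, Matrix.kroneckerMap_apply, smul_eq_mul,
    Finset.sum_mul]
  have h2 : ∑ k, ∑ l, ∑ s : Fin 2 × Fin 2, ∑ t : Fin 2 × Fin 2,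
      pauli k s.1 t.1 * pauli l s.2 t.2 * X t s * (pauli k a c * pauli l b d) =
      ∑ s : Fin 2 × Fin 2, ∑ t : Fin 2 × Fin 2, X t s *
        ((∑ k, pauli k s.1 t.1 * pauli k a c) * ∑ l, pauli l s.2 t.2 * pauli l b d) := by
    simp_rw [Finset.sum_mul_sum, Finset.mul_sum]
    rw [Finset.sum_congr rfl fun k _ => Finset.sum_comm]
    rw [Finset.sum_comm]
    refine Finset.sum_congr rfl fun s _ => ?_
    rw [Finset.sum_congr rfl fun k _ => Finset.sum_comm]
    rw [Finset.sum_comm]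
    refine Finset.sum_congr rfl fun t _ => Finset.sum_congr rfl fun k _ =>
      Finset.sum_congr rfl fun l _ => by ring
  rw [h2]
  simp_rw [sum_pauli_mul_pauli]
  rw [Finset.sum_eq_single (c, d), Finset.sum_eq_single (a, b)]
  · simp; ring
  · rintro ⟨t1, t2⟩ _ ht
    have : ¬ (t1 = a ∧ t2 = b) := fun h => ht (by rw [h.1, h.2])
    simp
    tauto
  · simp
  · rintro ⟨s1, s2⟩ _ hs
    refine Finset.sum_eq_zero fun t _ => ?_
    have : ¬ (s1 = c ∧ s2 = d) := fun h => hs (by rw [h.1, h.2])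
    simp
    tauto
  · simp

lemma trace_pauli_kron_mul {X : TwoQubitOp} (hX : X.IsHermitian) (k l : Fin 4) :
    ((pauli k ⊗ₖ pauli l) * X).trace = (pauliTr k l X : ℂ) := by
  have hH : (pauli k ⊗ₖ pauli l)ᴴ = pauli k ⊗ₖ pauli l := by
    rw [Matrix.conjTranspose_kronecker, (pauli_isHermitian k).eq, (pauli_isHermitian l).eq]
  have h : star ((pauli k ⊗ₖ pauli l) * X).trace = ((pauli k ⊗ₖ pauli l) * X).trace := by
    rw [← Matrix.trace_conjTranspose, Matrix.conjTranspose_mul, hX.eq, hH, Matrix.trace_mul_comm]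
  exact (Complex.conj_eq_iff_re.1 h).symm

/-- Pauli expansion of a Hermitian two-qubit operator. -/
lemma pauli_expansion_of_isHermitian {X : TwoQubitOp} (hX : X.IsHermitian) :
    X = (1 / 4 : ℂ) • ∑ k, ∑ l, (pauliTr k l X : ℂ) • (pauli k ⊗ₖ pauli l) := by
  conv_lhs => rw [pauli_expansion X]
  simp_rw [trace_pauli_kron_mul hX]

lemma re_trace_mul_of_isHermitian {X : TwoQubitOp} (hX : X.IsHermitian) (Y : TwoQubitOp) :
    (X * Y).trace.re = 1 / 4 * ∑ k, ∑ l, pauliTr k l X * pauliTr k l Y := by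
  conv_lhs => rw [pauli_expansion_of_isHermitian hX]
  have h : (1 / 4 : ℂ) = ((1 / 4 : ℝ) : ℂ) := by push_cast; rfl
  simp only [Matrix.smul_mul, Matrix.trace_smul, Finset.sum_mul, Matrix.trace_sum, smul_eq_mul]
  rw [h, Complex.re_ofReal_mul, Complex.re_sum]
  congr 1
  refine Finset.sum_congr rfl fun k _ => ?_
  rw [Complex.re_sum]
  exact Finset.sum_congr rfl fun l _ => by rw [Complex.re_ofReal_mul]; rfl

lemma pauliTr_zero_zero (X : TwoQubitOp) : pauliTr 0 0 X = X.trace.re := by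
  simp [pauliTr, pauli_zero]

end Pauli

/-! ### Operators on many qubits -/

section TensorProducts

variable {n : ℕ}

lemma tensorProd_mul (A B : Fin n → Matrix (Fin 2) (Fin 2) ℂ) :
    tensorProd A * tensorProd B = tensorProd fun i => A i * B i := by
  ext x y
  simp only [Matrix.mul_apply, tensorProd, Matrix.of_apply, ← Finset.prod_mul_distrib]
  rw [Finset.prod_univ_sum, Fintype.piFinset_univ]

lemma trace_tensorProd (A : Fin n → Matrix (Fin 2) (Fin 2) ℂ) :
    (tensorProd A).trace = ∏ i, (A i).trace := by
  simp only [Matrix.trace, tensorProd, Matrix.of_apply, Matrix.diag_apply]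
  rw [Finset.prod_univ_sum, Fintype.piFinset_univ]

lemma conjTranspose_tensorProd (A : Fin n → Matrix (Fin 2) (Fin 2) ℂ) :
    (tensorProd A)ᴴ = tensorProd fun i => (A i)ᴴ := by
  ext x y
  simp [tensorProd, Matrix.conjTranspose_apply]

lemma tensorProd_one : tensorProd (fun _ : Fin n => (1 : Matrix (Fin 2) (Fin 2) ℂ)) = 1 := by
  ext x y
  simp only [tensorProd, Matrix.of_apply, Matrix.one_apply]
  split_ifs with h
  · subst h; simp
  · obtain ⟨m, hm⟩ := Function.ne_iff.1 h
    exact Finset.prod_eq_zero (Finset.mem_univ m) (if_neg hm)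

/-- The family with `A` at position `i`, `B` at position `j` and the identity elsewhere. -/
def twoSite (i j : Fin n) (A B : Matrix (Fin 2) (Fin 2) ℂ) (m : Fin n) :
    Matrix (Fin 2) (Fin 2) ℂ :=
  if m = i then A else if m = j then B else 1

lemma extend_kronecker {i j : Fin n} (hij : i ≠ j) (A B : Matrix (Fin 2) (Fin 2) ℂ) :
    extend i j (A ⊗ₖ B) = tensorProd (twoSite i j A B) := by
  ext x y
  simp only [extend, tensorProd, twoSite, Matrix.of_apply, Matrix.kroneckerMap_apply]
  split_ifs with h
  · rw [Finset.prod_eq_mul i j hij]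
    · simp [hij.symm]
    · intro m _ hm
      rw [if_neg hm.1, if_neg hm.2, h m hm.1 hm.2, Matrix.one_apply_eq]
    · simp
    · simp
  · push Not at h
    obtain ⟨m, hmi, hmj, hm⟩ := h
    refine (Finset.prod_eq_zero (Finset.mem_univ m) ?_).symm
    rw [if_neg hmi, if_neg hmj, Matrix.one_apply_ne hm]

/-- `extend` as a linear map. -/
def extendₗ (i j : Fin n) : TwoQubitOp →ₗ[ℂ] NQubitOp n where
  toFun := extend i j
  map_add' X Y := by
    ext x y; simp only [extend, Matrix.of_apply, Matrix.add_apply]; split_ifs <;> simp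
  map_smul' c X := by
    ext x y; simp [extend, Matrix.of_apply, Matrix.smul_apply]

lemma extendₗ_apply (i j : Fin n) (X : TwoQubitOp) : extendₗ i j X = extend i j X := rfl

lemma extend_pauli_expansion (i j : Fin n) (X : TwoQubitOp) :
    extend i j X = (1 / 4 : ℂ) • ∑ k, ∑ l,
      ((pauli k ⊗ₖ pauli l) * X).trace • extend i j (pauli k ⊗ₖ pauli l) := by
  conv_lhs => rw [pauli_expansion X, ← extendₗ_apply]
  simp only [map_smul, map_sum, extendₗ_apply]

lemma extend_mul_kronecker {i j : Fin n} (hij : i ≠ j) (A B A' B' : Matrix (Fin 2) (Fin 2) ℂ) :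
    extend i j (A ⊗ₖ B) * extend i j (A' ⊗ₖ B') = extend i j ((A ⊗ₖ B) * (A' ⊗ₖ B')) := by
  rw [← Matrix.mul_kronecker_mul, extend_kronecker hij, extend_kronecker hij,
    extend_kronecker hij, tensorProd_mul]
  congr 1
  ext1 m
  unfold twoSite
  split_ifs <;> simp

/-- On pure tensors this is factorwise multiplication; the Pauli expansion extends it bilinearly. -/
lemma extend_mul {i j : Fin n} (hij : i ≠ j) (X Y : TwoQubitOp) :
    extend i j (X * Y) = extend i j X * extend i j Y := by
  conv_lhs => rw [pauli_expansion X, pauli_expansion Y, ← extendₗ_apply]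
  conv_rhs => rw [extend_pauli_expansion i j X, extend_pauli_expansion i j Y]
  simp only [Matrix.smul_mul, Matrix.mul_smul, Finset.sum_mul, Finset.mul_sum, map_smul, map_sum,
    extendₗ_apply, extend_mul_kronecker hij]

lemma extend_conjTranspose (i j : Fin n) (X : TwoQubitOp) :
    (extend i j X)ᴴ = extend i j Xᴴ := by
  ext x y
  simp only [extend, Matrix.conjTranspose_apply, Matrix.of_apply, eq_comm (a := x _)]
  split_ifs <;> simp

lemma extend_one (i j : Fin n) : extend i j 1 = 1 := by
  ext x y
  simp only [extend, Matrix.of_apply, Matrix.one_apply, Prod.mk.injEq]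
  by_cases h : x = y
  · simp [h]
  · rw [if_neg h]
    split_ifs with h1 h2
    · refine absurd (funext fun m => ?_) h
      by_cases hi : m = i
      · rw [hi]; exact h2.1
      by_cases hj : m = j
      · rw [hj]; exact h2.2
      exact h1 m hi hj
    · rfl
    · rfl

lemma trace_extend_mul_tensorProd {i j : Fin n} (hij : i ≠ j) (X : TwoQubitOp)
    {A : Fin n → Matrix (Fin 2) (Fin 2) ℂ} (hA : ∀ m, (A m).trace = 1) :
    (extend i j X * tensorProd A).trace = (X * (A i ⊗ₖ A j)).trace := by
  conv_lhs => rw [extend_pauli_expansion i j X]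
  conv_rhs => rw [pauli_expansion X]
  simp only [Matrix.smul_mul, Finset.sum_mul, Matrix.trace_smul, Matrix.trace_sum]
  congr 1
  refine Finset.sum_congr rfl fun k _ => Finset.sum_congr rfl fun l _ => ?_
  rw [extend_kronecker hij, tensorProd_mul, trace_tensorProd, ← Matrix.mul_kronecker_mul,
    Matrix.trace_kronecker, Finset.prod_eq_mul i j hij]
  · simp [twoSite, hij.symm]
  · intro m _ hm
    simp [twoSite, hm.1, hm.2, hA]
  · simp
  · simp

end TensorProducts

/-! ### Positivity and projectors -/

section Positivity

variable {ι : Type*} [Fintype ι]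

/-- Rank-one test matrices suffice. This is how positivity passes to reduced states, which are known
through their trace pairings. -/
lemma posSemidef_of_trace_mul_nonneg {B : Matrix ι ι ℂ} (hB : B.IsHermitian)
    (h : ∀ A : Matrix ι ι ℂ, A.PosSemidef → 0 ≤ (A * B).trace) : B.PosSemidef := by
  refine Matrix.PosSemidef.of_dotProduct_mulVec_nonneg hB fun x => ?_
  have := h _ (Matrix.posSemidef_vecMulVec_self_star x)
  rwa [Matrix.vecMulVec_mul, Matrix.trace_vecMulVec, dotProduct_comm, ← Matrix.dotProduct_mulVec]
    at this

lemma re_trace_mul_comm_of_isHermitian {A B C : Matrix ι ι ℂ} (hA : A.IsHermitian)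
    (hB : B.IsHermitian) (hC : C.IsHermitian) : (A * B * C).trace.re = (B * A * C).trace.re := by
  have h : star (A * B * C).trace = (B * A * C).trace := by
    rw [← Matrix.trace_conjTranspose, Matrix.conjTranspose_mul, Matrix.conjTranspose_mul, hA.eq,
      hB.eq, hC.eq, Matrix.trace_mul_comm]
  rw [← h]
  rfl

lemma posSemidef_of_isStarProjection {P : Matrix ι ι ℂ} (hP : IsStarProjection P) :
    P.PosSemidef := by
  have h : P = Pᴴ * P := by
    have h1 : Pᴴ = P := hP.isSelfAdjoint
    rw [h1, hP.isIdempotentElem.eq]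
  rw [h]
  exact Matrix.posSemidef_conjTranspose_mul_self P
variable [DecidableEq ι]

open scoped MatrixOrder Matrix.Norms.L2Operator in
lemma exists_eq_conjTranspose_mul_self {A : Matrix ι ι ℂ} (hA : A.PosSemidef) :
    ∃ C : Matrix ι ι ℂ, A = Cᴴ * C :=
  CStarAlgebra.nonneg_iff_eq_star_mul_self.1 hA.nonneg

lemma trace_mul_nonneg_of_posSemidef {A B : Matrix ι ι ℂ} (hA : A.PosSemidef)
    (hB : B.PosSemidef) : 0 ≤ (A * B).trace := by
  obtain ⟨C, rfl⟩ := exists_eq_conjTranspose_mul_self hB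
  rw [← Matrix.mul_assoc, Matrix.trace_mul_comm, ← Matrix.mul_assoc]
  exact (hA.mul_mul_conjTranspose_same C).trace_nonneg

lemma trace_eq_rank_of_isIdempotentElem {P : Matrix ι ι ℂ} (hP : IsIdempotentElem P) :
    P.trace = P.rank := by
  have h : IsIdempotentElem (Matrix.toLin' P) := by
    rw [IsIdempotentElem, Module.End.mul_eq_comp, ← Matrix.toLin'_mul, hP.eq]
  have := (LinearMap.IsIdempotentElem.isProj_range _ h).trace
  rw [Matrix.trace_toLin'_eq] at this
  exact this

lemma re_trace_mul_mem_Icc {P ρ : Matrix ι ι ℂ} (hP : IsStarProjection P) (hρ : IsDensity ρ) :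
    0 ≤ (P * ρ).trace.re ∧ (P * ρ).trace.re ≤ 1 := by
  have h1 := trace_mul_nonneg_of_posSemidef (posSemidef_of_isStarProjection hP) hρ.1
  have h2 := trace_mul_nonneg_of_posSemidef (posSemidef_of_isStarProjection hP.one_sub) hρ.1
  rw [Matrix.sub_mul, Matrix.one_mul, Matrix.trace_sub, hρ.2] at h2
  have h1' := (Complex.le_def.1 h1).1
  have h2' := (Complex.le_def.1 h2).1
  simp at h1' h2'
  exact ⟨h1', h2'⟩

end Positivity

/-! ### The spin flip -/

section SpinFlip

/-- The sign of a Pauli matrix under the spin flip. -/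
def flipSign (k : Fin 4) : ℝ := if k = 0 then 1 else -1

lemma pauli_two_conj (k : Fin 4) :
    pauli 2 * pauli k * pauli 2 = (flipSign k : ℂ) • (pauli k)ᵀ := by
  ext a b
  fin_cases k <;> fin_cases a <;> fin_cases b <;>
    simp [pauli, flipSign, Matrix.mul_apply]

/-- The spin flip of a two-qubit density matrix negates all local Pauli coefficients. -/
lemma exists_spinFlip {ρ : TwoQubitOp} (hρ : IsDensity ρ) :
    ∃ ρ' : TwoQubitOp, IsDensity ρ' ∧
      ∀ k l, pauliTr k l ρ' = flipSign k * flipSign l * pauliTr k l ρ := by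
  have hY : (pauli 2 ⊗ₖ pauli 2)ᴴ = pauli 2 ⊗ₖ pauli 2 := by
    rw [Matrix.conjTranspose_kronecker, (pauli_isHermitian 2).eq]
  have hYY : (pauli 2 ⊗ₖ pauli 2) * (pauli 2 ⊗ₖ pauli 2) = 1 := by
    rw [← Matrix.mul_kronecker_mul, pauli_mul_self, Matrix.one_kronecker_one]
  -- Conjugation by `σ²` sends each nontrivial Pauli matrix to minus its transpose, and the
  -- transpose on `ρ` cancels the one on the Pauli matrices.
  refine ⟨(pauli 2 ⊗ₖ pauli 2) * ρᵀ * (pauli 2 ⊗ₖ pauli 2), ⟨?_, ?_⟩, fun k l => ?_⟩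
  · have := hρ.1.transpose.mul_mul_conjTranspose_same (pauli 2 ⊗ₖ pauli 2)
    rwa [hY] at this
  · rw [Matrix.trace_mul_comm, ← Matrix.mul_assoc, hYY, Matrix.one_mul, Matrix.trace_transpose,
      hρ.2]
  · have h : ((pauli k ⊗ₖ pauli l) * ((pauli 2 ⊗ₖ pauli 2) * ρᵀ * (pauli 2 ⊗ₖ pauli 2))).trace =
        ((flipSign k * flipSign l : ℝ) : ℂ) * ((pauli k ⊗ₖ pauli l) * ρ).trace := by
      rw [← Matrix.mul_assoc, Matrix.trace_mul_comm, ← Matrix.mul_assoc, ← Matrix.mul_assoc,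
        ← Matrix.mul_kronecker_mul, ← Matrix.mul_kronecker_mul, pauli_two_conj, pauli_two_conj,
        Matrix.smul_kronecker, Matrix.kronecker_smul, Matrix.smul_mul, Matrix.smul_mul,
        Matrix.trace_smul, Matrix.trace_smul, Matrix.kroneckerMap_transpose,
        ← Matrix.transpose_mul, Matrix.trace_transpose, Matrix.trace_mul_comm]
      simp [mul_assoc]
    rw [pauliTr, h, Complex.re_ofReal_mul]
    rfl

end SpinFlip

/-! ### Reduced states and moment matrices -/

section Reduced

variable {n : ℕ}

/-- The reduced state of `ρ` on the qubits `i` and `j`. -/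
def reduced (i j : Fin n) (ρ : NQubitOp n) : TwoQubitOp :=
  -- The order `t s` is reversed so that the trace pairing with `X` gives `X` itself and not its
  -- transpose.
  Matrix.of fun s t => (extend i j (Matrix.single t s 1) * ρ).trace

lemma trace_mul_reduced (i j : Fin n) (ρ : NQubitOp n) (X : TwoQubitOp) :
    (X * reduced i j ρ).trace = (extend i j X * ρ).trace := by
  have h : extend i j X = ∑ s, ∑ t, X s t • extend i j (Matrix.single s t 1) := by
    conv_lhs => rw [Matrix.matrix_eq_sum_single X, ← extendₗ_apply, map_sum]
    refine Finset.sum_congr rfl fun s _ => ?_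
    rw [map_sum]
    refine Finset.sum_congr rfl fun t _ => ?_
    rw [← extendₗ_apply, ← map_smul, Matrix.smul_single, smul_eq_mul, mul_one]
  rw [h]
  simp only [Finset.sum_mul, Matrix.trace_sum, Matrix.smul_mul, Matrix.trace_smul]
  simp [Matrix.trace, Matrix.mul_apply, reduced]

lemma posSemidef_extend {i j : Fin n} (hij : i ≠ j) {X : TwoQubitOp} (hX : X.PosSemidef) :
    (extend i j X).PosSemidef := by
  obtain ⟨C, rfl⟩ := exists_eq_conjTranspose_mul_self hX
  rw [extend_mul hij, ← extend_conjTranspose]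
  exact Matrix.posSemidef_conjTranspose_mul_self _

lemma isDensity_reduced {i j : Fin n} (hij : i ≠ j) {ρ : NQubitOp n} (hρ : IsDensity ρ) :
    IsDensity (reduced i j ρ) := by
  refine ⟨posSemidef_of_trace_mul_nonneg ?_ fun A hA => ?_, ?_⟩
  · ext s t
    simp only [Matrix.conjTranspose_apply, reduced, Matrix.of_apply]
    rw [← Matrix.trace_conjTranspose, Matrix.conjTranspose_mul, hρ.1.isHermitian.eq,
      extend_conjTranspose, Matrix.trace_mul_comm, Matrix.conjTranspose_single, star_one]
  · rw [trace_mul_reduced]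
    exact trace_mul_nonneg_of_posSemidef (posSemidef_extend hij hA) hρ.1
  · have := trace_mul_reduced i j ρ 1
    rwa [Matrix.one_mul, extend_one, Matrix.one_mul, hρ.2] at this

lemma pauliTr_reduced {i j : Fin n} (hij : i ≠ j) (ρ : NQubitOp n) (k l : Fin 4) :
    pauliTr k l (reduced i j ρ) =
      (tensorProd (twoSite i j (pauli k) (pauli l)) * ρ).trace.re := by
  rw [pauliTr, trace_mul_reduced, extend_kronecker hij]

/-- The operator belonging to a label of the moment matrix. -/
def labelOp : Label n → NQubitOp n
  | none => 1
  | some (i, k) => tensorProd fun m => if m = i then pauli k.succ else 1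

lemma isHermitian_labelOp (a : Label n) : (labelOp a).IsHermitian := by
  rcases a with _ | ⟨i, k⟩
  · exact Matrix.isHermitian_one
  · change (tensorProd _)ᴴ = _
    rw [conjTranspose_tensorProd]
    congr 1
    ext1 m
    split_ifs
    · exact pauli_isHermitian _
    · exact Matrix.conjTranspose_one

lemma labelOp_some_mul_some {i j : Fin n} (hij : i ≠ j) (k l : Fin 3) :
    labelOp (some (i, k)) * labelOp (some (j, l)) =
      tensorProd (twoSite i j (pauli k.succ) (pauli l.succ)) := by
  simp only [labelOp, tensorProd_mul]
  congr 1
  ext1 m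
  by_cases hi : m = i
  · subst hi; simp [twoSite, hij]
  · simp [twoSite, hi]

lemma labelOp_some_eq_left {i j : Fin n} (k : Fin 3) :
    labelOp (some (i, k)) = tensorProd (twoSite i j (pauli k.succ) (pauli 0)) := by
  simp only [labelOp, pauli_zero]
  congr 1
  ext1 m
  simp only [twoSite]
  split_ifs <;> rfl

lemma labelOp_some_eq_right {i j : Fin n} (hij : i ≠ j) (l : Fin 3) :
    labelOp (some (j, l)) = tensorProd (twoSite i j (pauli 0) (pauli l.succ)) := by
  simp only [labelOp, pauli_zero]
  congr 1
  ext1 m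
  by_cases hi : m = i
  · subst hi; simp [twoSite, hij]
  · simp [twoSite, hi]

lemma labelOp_some_mul_self (i : Fin n) (k : Fin 3) :
    labelOp (some (i, k)) * labelOp (some (i, k)) = 1 := by
  simp only [labelOp, tensorProd_mul]
  rw [← tensorProd_one]
  congr 1
  ext1 m
  split_ifs
  · exact pauli_mul_self _
  · exact one_mul 1

lemma labelOp_some_anticomm (i : Fin n) {k l : Fin 3} (h : k ≠ l) :
    labelOp (some (i, k)) * labelOp (some (i, l)) +
      labelOp (some (i, l)) * labelOp (some (i, k)) = 0 := by
  simp only [labelOp, tensorProd_mul]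
  ext x y
  have hprod : ∀ A : Matrix (Fin 2) (Fin 2) ℂ,
      ∏ m, (if m = i then A else 1 : Matrix (Fin 2) (Fin 2) ℂ) (x m) (y m) =
      A (x i) (y i) * ∏ m ∈ Finset.univ.erase i,
        (1 : Matrix (Fin 2) (Fin 2) ℂ) (x m) (y m) := fun A => by
    rw [← Finset.mul_prod_erase _ _ (Finset.mem_univ i), if_pos rfl]
    congr 1
    refine Finset.prod_congr rfl fun m hm => ?_
    rw [if_neg (Finset.ne_of_mem_erase hm)]
  have hite : ∀ (m : Fin n) (k l : Fin 3),
      (if m = i then pauli k.succ else 1) * (if m = i then pauli l.succ else 1) =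
      if m = i then pauli k.succ * pauli l.succ else 1 := fun m k l => by
    split_ifs <;> simp
  simp only [hite, Matrix.add_apply, tensorProd, Matrix.of_apply, hprod, ← add_mul]
  rw [← Matrix.add_apply, pauli_anticomm h]
  simp

/-- The moment matrix of a state. -/
def momentMatrix (ρ : NQubitOp n) : Matrix (Label n) (Label n) ℝ :=
  Matrix.of fun a b => (labelOp a * labelOp b * ρ).trace.re

/-- The quadratic form at `x` is `Tr[B² ρ]` for the Hermitian operator `B = ∑ x a • labelOp a`. -/
lemma posSemidef_momentMatrix {ρ : NQubitOp n} (hρ : ρ.PosSemidef) :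
    (momentMatrix ρ).PosSemidef := by
  refine Matrix.PosSemidef.of_dotProduct_mulVec_nonneg ?_ fun x => ?_
  · ext a b
    simp only [Matrix.conjTranspose_apply, momentMatrix, Matrix.of_apply, star_trivial]
    exact re_trace_mul_comm_of_isHermitian (isHermitian_labelOp _) (isHermitian_labelOp _)
      hρ.isHermitian
  · let B : NQubitOp n := ∑ a, (x a : ℂ) • labelOp a
    have hB : Bᴴ = B := by
      simp only [B, Matrix.conjTranspose_sum, Matrix.conjTranspose_smul,
        (isHermitian_labelOp _).eq]
      refine Finset.sum_congr rfl fun a _ => ?_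
      simp
    have h := trace_mul_nonneg_of_posSemidef (Matrix.posSemidef_conjTranspose_mul_self B) hρ
    have h' := (Complex.le_def.1 h).1
    rw [hB] at h'
    have he : (B * B * ρ).trace = ∑ a, ∑ b, ((x a * x b : ℝ) : ℂ) *
        (labelOp a * labelOp b * ρ).trace := by
      simp only [B, Finset.sum_mul, Finset.mul_sum, Matrix.smul_mul, Matrix.mul_smul,
        Matrix.trace_sum, Matrix.trace_smul, smul_smul, smul_eq_mul, Complex.ofReal_mul]
      rw [Finset.sum_comm]
      refine Finset.sum_congr rfl fun a _ => Finset.sum_congr rfl fun b _ => by ring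
    rw [he] at h'
    simp only [Complex.re_sum, Complex.re_ofReal_mul] at h'
    simp only [dotProduct, Matrix.mulVec, Finset.mul_sum, momentMatrix, Matrix.of_apply,
      star_trivial]
    refine h'.trans (le_of_eq ?_)
    refine Finset.sum_congr rfl fun a _ => Finset.sum_congr rfl fun b _ => ?_
    simp [mul_assoc, mul_comm]

end Reduced

/-! ### The semidefinite program as a relaxation -/

section Objective

lemma sum_ite_ite_eq {α : Type*} [Fintype α] [DecidableEq α] {u w : α} (h : u ≠ w)
    (f g : α → ℝ) :
    ∑ i, (if i = u then f i else if i = w then g i else 0) = f u + g w := by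
  have : ∀ i, (if i = u then f i else if i = w then g i else 0) =
      (if i = u then f i else 0) + if i = w then g i else 0 := fun i => by
    by_cases h1 : i = u
    · subst h1; simp [h]
    · simp [h1]
  simp_rw [this]
  rw [Finset.sum_add_distrib]
  simp

/-- The Pauli coefficients of a product, split into constant, local and two-qubit terms. -/
lemma four_mul_re_trace_mul {X : TwoQubitOp} (hX : X.IsHermitian) (Y : TwoQubitOp) :
    4 * (X * Y).trace.re = pauliTr 0 0 X * pauliTr 0 0 Y +
      ((∑ k : Fin 3, pauliTr k.succ 0 X * pauliTr k.succ 0 Y) +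
        ∑ l : Fin 3, pauliTr 0 l.succ X * pauliTr 0 l.succ Y) +
      ∑ k : Fin 3, ∑ l : Fin 3, pauliTr k.succ l.succ X * pauliTr k.succ l.succ Y := by
  rw [re_trace_mul_of_isHermitian hX, Fin.sum_univ_succ, Fin.sum_univ_succ]
  simp_rw [fun k : Fin 3 => Fin.sum_univ_succ
    fun l => pauliTr k.succ l X * pauliTr k.succ l Y]
  rw [Finset.sum_add_distrib]
  ring

namespace Instance

variable {n : ℕ} {E : Type*}

/-- Every coefficient occurs twice in the symmetric value matrix, which turns `1/8` into `1/4`. -/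
lemma trace_valueMatrix_mul (A : Instance n E) (e : E) {M : Matrix (Label n) (Label n) ℝ}
    (hM : ∀ a b, M a b = M b a) :
    (A.valueMatrix e * M).trace = 1 / 4 *
      ((∑ k, pauliTr k.succ 0 (A.op e) * M (some (A.fst e, k)) none) +
        (∑ l, pauliTr 0 l.succ (A.op e) * M (some (A.snd e, l)) none) +
        ∑ k, ∑ l, pauliTr k.succ l.succ (A.op e) *
          M (some (A.fst e, k)) (some (A.snd e, l))) := by
  have hne := A.fst_ne_snd e
  have h1 : ∑ a : Fin n × Fin 3, A.valueMatrix e (some a) none * M none (some a) =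
      1 / 8 * ((∑ k, pauliTr k.succ 0 (A.op e) * M (some (A.fst e, k)) none) +
        ∑ l, pauliTr 0 l.succ (A.op e) * M (some (A.snd e, l)) none) := by
    rw [Fintype.sum_prod_type, Finset.sum_comm, ← Finset.sum_add_distrib, Finset.mul_sum]
    refine Finset.sum_congr rfl fun k _ => ?_
    simp only [valueMatrix, Matrix.of_apply, ite_mul, zero_mul]
    rw [sum_ite_ite_eq hne (fun i => pauliTr k.succ 0 (A.op e) / 8 * M none (some (i, k)))
      (fun i => pauliTr 0 k.succ (A.op e) / 8 * M none (some (i, k))), hM none, hM none]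
    ring
  have h2 : ∑ a : Fin n × Fin 3, A.valueMatrix e none (some a) * M (some a) none =
      ∑ a : Fin n × Fin 3, A.valueMatrix e (some a) none * M none (some a) :=
    Finset.sum_congr rfl fun a _ => by rw [hM none]; rfl
  have h3 : ∑ a : Fin n × Fin 3, ∑ b : Fin n × Fin 3,
      A.valueMatrix e (some a) (some b) * M (some b) (some a) =
      1 / 4 * ∑ k, ∑ l, pauliTr k.succ l.succ (A.op e) *
          M (some (A.fst e, k)) (some (A.snd e, l)) := by
    have hk : ∀ k l : Fin 3, ∑ i, ∑ j,
        A.valueMatrix e (some (i, k)) (some (j, l)) * M (some (j, l)) (some (i, k)) =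
        1 / 8 * (pauliTr k.succ l.succ (A.op e) * M (some (A.fst e, k)) (some (A.snd e, l))) +
        1 / 8 * (pauliTr l.succ k.succ (A.op e) *
          M (some (A.fst e, l)) (some (A.snd e, k))) := fun k l => by
      simp only [valueMatrix, Matrix.of_apply, ite_mul, zero_mul]
      rw [← Fintype.sum_prod_type']
      have := sum_ite_ite_eq (u := (A.fst e, A.snd e)) (w := (A.snd e, A.fst e))
        (fun h => hne (Prod.mk.inj h).1)
        (fun p => pauliTr k.succ l.succ (A.op e) / 8 * M (some (p.2, l)) (some (p.1, k)))
        (fun p => pauliTr l.succ k.succ (A.op e) / 8 * M (some (p.2, l)) (some (p.1, k)))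
      simp only [Prod.ext_iff] at this
      rw [this, hM (some (A.snd e, l)), hM (some (A.fst e, l))]
      rw [hM (some (A.snd e, k))]
      ring
    simp_rw [Fintype.sum_prod_type]
    rw [Finset.sum_comm]
    have hc : ∀ k, ∑ i, ∑ j, ∑ l,
        A.valueMatrix e (some (i, k)) (some (j, l)) * M (some (j, l)) (some (i, k)) =
        ∑ l, ∑ i, ∑ j,
        A.valueMatrix e (some (i, k)) (some (j, l)) * M (some (j, l)) (some (i, k)) :=
      fun k => by
        rw [Finset.sum_congr rfl fun i _ => Finset.sum_comm, Finset.sum_comm]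
    simp_rw [hc, hk, Finset.sum_add_distrib, ← Finset.mul_sum]
    rw [Finset.sum_comm (f := fun k l => pauliTr (Fin.succ l) (Fin.succ k) (A.op e) *
          M (some (A.fst e, l)) (some (A.snd e, k)))]
    ring
  have h0 : (A.valueMatrix e * M).trace = ∑ a, ∑ b, A.valueMatrix e a b * M b a := rfl
  have h00 : A.valueMatrix e none none = 0 := rfl
  rw [h0, Fintype.sum_option, Fintype.sum_option, h00, h2]
  simp_rw [fun a : Fin n × Fin 3 => Fintype.sum_option
    fun b => A.valueMatrix e (some a) b * M b (some a)]
  rw [Finset.sum_add_distrib, h1, h3]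
  ring

/-- A feasible point values each term by its two-qubit marginal. -/
lemma SDPFeasible.term_eq {A : Instance n E} {M : Matrix (Label n) (Label n) ℝ}
    {ρ : E → TwoQubitOp} (h : A.SDPFeasible M ρ) (e : E) :
    (A.op e).trace.re / 4 + (A.valueMatrix e * M).trace = (A.op e * ρ e).trace.re := by
  have hM : ∀ a b, M a b = M b a := fun a b => by
    simpa using congrFun (congrFun h.posSemidef.isHermitian b) a
  have h4 := four_mul_re_trace_mul (A.isHermitian e) (ρ e)
  have h0 : pauliTr 0 0 (ρ e) = 1 := by rw [pauliTr_zero_zero, (h.density e).2, Complex.one_re]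
  rw [trace_valueMatrix_mul A e hM]
  simp_rw [h.one_marginal_fst, h.one_marginal_snd, h.two_marginal]
  rw [h0, pauliTr_zero_zero] at h4
  linarith

lemma sdpFeasible_momentMatrix (A : Instance n E) {ρ : NQubitOp n} (hρ : IsDensity ρ) :
    A.SDPFeasible (momentMatrix ρ) (fun e => reduced (A.fst e) (A.snd e) ρ) where
  id_id := by simp [momentMatrix, labelOp, hρ.2]
  diag i k := by
    simp only [momentMatrix, Matrix.of_apply]
    rw [labelOp_some_mul_self, Matrix.one_mul, hρ.2, Complex.one_re]
  diag_block i k l hkl := by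
    simp only [momentMatrix, Matrix.of_apply]
    -- The two orders of the product have equal real traces against `ρ`, while anticommutation makes
    -- these sum to zero.
    have h1 := re_trace_mul_comm_of_isHermitian (isHermitian_labelOp (some (i, k)))
      (isHermitian_labelOp (some (i, l))) hρ.1.isHermitian
    have h2 := congrArg (fun X => (X * ρ).trace.re) (labelOp_some_anticomm i hkl)
    simp only [Matrix.add_mul, Matrix.trace_add, Complex.add_re, Matrix.zero_mul,
      Matrix.trace_zero, Complex.zero_re] at h2
    linarith
  two_marginal e k l := by
    rw [pauliTr_reduced (A.fst_ne_snd e), ← labelOp_some_mul_some (A.fst_ne_snd e)]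
    rfl
  one_marginal_fst e k := by
    rw [pauliTr_reduced (A.fst_ne_snd e), ← labelOp_some_eq_left]
    simp only [momentMatrix, Matrix.of_apply]
    rw [show labelOp (none : Label n) = 1 from rfl, Matrix.mul_one]
  one_marginal_snd e l := by
    rw [pauliTr_reduced (A.fst_ne_snd e), ← labelOp_some_eq_right (A.fst_ne_snd e)]
    simp only [momentMatrix, Matrix.of_apply]
    rw [show labelOp (none : Label n) = 1 from rfl, Matrix.mul_one]
  density e := isDensity_reduced (A.fst_ne_snd e) hρ
  posSemidef := posSemidef_momentMatrix hρ.1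

variable [Fintype E]

lemma re_trace_hamiltonian_mul (A : Instance n E) (ρ : NQubitOp n) :
    (A.hamiltonian * ρ).trace.re =
      ∑ e, A.weight e * (extend (A.fst e) (A.snd e) (A.op e) * ρ).trace.re := by
  simp only [hamiltonian, term, Finset.sum_mul, Matrix.trace_sum, Complex.re_sum,
    Matrix.smul_mul, Matrix.trace_smul, smul_eq_mul, Complex.re_ofReal_mul]

/-- The semidefinite program is a relaxation. -/
lemma lambdaMax_le_sdpObjective (A : Instance n E) {M : Matrix (Label n) (Label n) ℝ}
    (hM : A.IsOptimalMoment M) : lambdaMax A.hamiltonian ≤ A.sdpObjective M := by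
  refine csSup_le ?_ ?_
  -- A computational basis state shows that the set under the supremum is nonempty.
  · let x : Fin n → Fin 2 := 0
    refine ⟨_, Matrix.vecMulVec (Pi.single x 1) (star (Pi.single x 1)),
      ⟨Matrix.posSemidef_vecMulVec_self_star _, ?_⟩, rfl⟩
    rw [Matrix.trace_vecMulVec]
    simp
  · rintro _ ⟨ρ, hρ, rfl⟩
    have hf := A.sdpFeasible_momentMatrix hρ
    refine le_trans (le_of_eq ?_) (hM.2 _ _ hf)
    rw [re_trace_hamiltonian_mul, sdpObjective]
    exact Finset.sum_congr rfl fun e _ => by rw [hf.term_eq, trace_mul_reduced]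

end Instance

end Objective

/-! ### The value of a term on the rounded product state -/

section Rounding

variable {n d : ℕ}

/-- The Bloch representation of a single-qubit state. -/
noncomputable def blochState (θ : Fin 3 → ℝ) : Matrix (Fin 2) (Fin 2) ℂ :=
  (1 / 2 : ℂ) • (1 + ∑ k : Fin 3, (θ k : ℂ) • pauli k.succ)

lemma trace_pauli_zero_mul_blochState (θ : Fin 3 → ℝ) : (pauli 0 * blochState θ).trace = 1 := by
  simp [pauli_zero, blochState, Matrix.trace_sum, Matrix.trace_add, trace_pauli_succ]

lemma trace_pauli_succ_mul_blochState (θ : Fin 3 → ℝ) (k : Fin 3) :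
    (pauli k.succ * blochState θ).trace = θ k := by
  simp [blochState, Matrix.mul_add, Finset.mul_sum, Matrix.trace_sum, Matrix.trace_add,
    trace_pauli_succ, trace_pauli_mul_pauli]
  ring

lemma four_mul_re_trace_mul_blochState {X : TwoQubitOp} (hX : X.IsHermitian)
    (θ θ' : Fin 3 → ℝ) :
    4 * (X * (blochState θ ⊗ₖ blochState θ')).trace.re = X.trace.re +
      ((∑ k : Fin 3, pauliTr k.succ 0 X * θ k) + ∑ l : Fin 3, pauliTr 0 l.succ X * θ' l) +
      ∑ k : Fin 3, ∑ l : Fin 3, pauliTr k.succ l.succ X * (θ k * θ' l) := by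
  rw [four_mul_re_trace_mul hX, pauliTr_zero_zero]
  simp only [pauliTr, ← Matrix.mul_kronecker_mul, Matrix.trace_kronecker,
    trace_pauli_zero_mul_blochState, trace_pauli_succ_mul_blochState, mul_one, one_mul,
    Complex.one_re, Complex.ofReal_re, ← Complex.ofReal_mul]

/-- The Cholesky vectors of the Pauli operators on qubit `i`. -/
noncomputable def siteVec (v : Label n → EuclideanSpace ℝ (Fin d)) (i : Fin n) (k : Fin 3) :
    EuclideanSpace ℝ (Fin d) :=
  v (some (i, k))

lemma blochCoord_eq (v : Label n → EuclideanSpace ℝ (Fin d)) (r : EuclideanSpace ℝ (Fin d))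
    (i : Fin n) (k : Fin 3) : blochCoord v r i k =
      sgn ⟪v none, r⟫ * (⟪siteVec v i k, r⟫ / √(projSq (siteVec v i) r)) := rfl

lemma sgn_mul_sgn (x : ℝ) : sgn x * sgn x = 1 := by
  unfold sgn; split_ifs <;> norm_num

lemma trace_blochState (θ : Fin 3 → ℝ) : (blochState θ).trace = 1 := by
  have := trace_pauli_zero_mul_blochState θ
  rwa [pauli_zero, Matrix.one_mul] at this

/-- The value of a term on the rounded state. -/
lemma re_trace_extend_mul_roundedState {i j : Fin n} (hij : i ≠ j) {X : TwoQubitOp}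
    (hX : X.IsHermitian) (v : Label n → EuclideanSpace ℝ (Fin d))
    (r : EuclideanSpace ℝ (Fin d)) :
    (extend i j X * roundedState v r).trace.re = 1 / 4 * (X.trace.re +
      ((∑ k, pauliTr k.succ 0 X *
          (sgn ⟪v none, r⟫ * (⟪siteVec v i k, r⟫ / √(projSq (siteVec v i) r)))) +
        ∑ l, pauliTr 0 l.succ X *
          (sgn ⟪v none, r⟫ * (⟪siteVec v j l, r⟫ / √(projSq (siteVec v j) r)))) +
      ∑ k, ∑ l, pauliTr k.succ l.succ X *
        (⟪siteVec v i k, r⟫ / √(projSq (siteVec v i) r) *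
          (⟪siteVec v j l, r⟫ / √(projSq (siteVec v j) r)))) := by
  have h := trace_extend_mul_tensorProd hij X
    (A := fun m => blochState (blochCoord v r m)) (fun m => trace_blochState _)
  have h' : (extend i j X * roundedState v r).trace =
      (X * (blochState (blochCoord v r i) ⊗ₖ blochState (blochCoord v r j))).trace := h
  rw [h', ← mul_right_inj' (four_ne_zero (α := ℝ)), four_mul_re_trace_mul_blochState hX]
  -- The common sign cancels in two-qubit terms, so only the local terms depend on `v none`.
  have hs : ∀ a b : ℝ, sgn ⟪v none, r⟫ * a * (sgn ⟪v none, r⟫ * b) = a * b := fun a b => by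
    rw [mul_mul_mul_comm, sgn_mul_sgn, one_mul]
  simp_rw [blochCoord_eq, hs]
  ring

end Rounding

/-! ### Expectations of rounded terms -/

section Expectation

variable {F : Type*} [NormedAddCommGroup F] [InnerProductSpace ℝ F] [FiniteDimensional ℝ F]
  [MeasurableSpace F] [BorelSpace F]

lemma integrable_sgn_mul_ratio (w : F) (x : Fin 3 → F) (a : Fin 3) :
    Integrable (fun r => sgn ⟪w, r⟫ * (⟪x a, r⟫ / √(projSq x r))) (stdGaussian F) :=
  (integrable_ratio x a).bdd_mul (c := 1)
    (measurable_sgn.comp (by fun_prop)).aestronglyMeasurable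
    (Filter.Eventually.of_forall fun r => by rw [Real.norm_eq_abs, abs_sgn])

/-- The expectation of a two-qubit term after rounding, from the moments of the rounding. -/
lemma integrable_and_integral_rounded (w : F) (x y : Fin 3 → F) (s : ℝ) (p q : Fin 3 → ℝ)
    (t : Fin 3 → Fin 3 → ℝ) :
    let Φ : F → ℝ := fun r => 1 / 4 * (s +
      ((∑ k, p k * (sgn ⟪w, r⟫ * (⟪x k, r⟫ / √(projSq x r)))) +
        ∑ l, q l * (sgn ⟪w, r⟫ * (⟪y l, r⟫ / √(projSq y r)))) +
      ∑ k, ∑ l, t k l * (⟪x k, r⟫ / √(projSq x r) * (⟪y l, r⟫ / √(projSq y r))))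
    Integrable Φ (stdGaussian F) ∧ ∫ r, Φ r ∂stdGaussian F = 1 / 4 * (s +
      ((∑ k, p k * ∫ r, sgn ⟪w, r⟫ * (⟪x k, r⟫ / √(projSq x r)) ∂stdGaussian F) +
        ∑ l, q l * ∫ r, sgn ⟪w, r⟫ * (⟪y l, r⟫ / √(projSq y r)) ∂stdGaussian F) +
      ∑ k, ∑ l, t k l *
        ∫ r, ⟪x k, r⟫ / √(projSq x r) * (⟪y l, r⟫ / √(projSq y r)) ∂stdGaussian F) := by
  intro Φ
  have ip : ∀ k ∈ Finset.univ, Integrable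
      (fun r => p k * (sgn ⟪w, r⟫ * (⟪x k, r⟫ / √(projSq x r)))) (stdGaussian F) :=
    fun k _ => (integrable_sgn_mul_ratio w x k).const_mul _
  have iq : ∀ k ∈ Finset.univ, Integrable
      (fun r => q k * (sgn ⟪w, r⟫ * (⟪y k, r⟫ / √(projSq y r)))) (stdGaussian F) :=
    fun k _ => (integrable_sgn_mul_ratio w y k).const_mul _
  have it : ∀ k, ∀ l ∈ Finset.univ, Integrable
      (fun r => t k l * (⟪x k, r⟫ / √(projSq x r) * (⟪y l, r⟫ / √(projSq y r))))
      (stdGaussian F) :=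
    fun k l _ => (integrable_ratio_mul k (integrable_ratio y l)).const_mul _
  have jt : ∀ k ∈ Finset.univ, Integrable
      (fun r => ∑ l, t k l * (⟪x k, r⟫ / √(projSq x r) * (⟪y l, r⟫ / √(projSq y r))))
      (stdGaussian F) := fun k _ => integrable_finsetSum _ (it k)
  have jp := integrable_finsetSum _ ip
  have jq := integrable_finsetSum _ iq
  have jpq : Integrable (fun r => (∑ k, p k * (sgn ⟪w, r⟫ * (⟪x k, r⟫ / √(projSq x r)))) +
        ∑ l, q l * (sgn ⟪w, r⟫ * (⟪y l, r⟫ / √(projSq y r)))) (stdGaussian F) := jp.add jq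
  have js : Integrable (fun r => s +
      ((∑ k, p k * (sgn ⟪w, r⟫ * (⟪x k, r⟫ / √(projSq x r)))) +
        ∑ l, q l * (sgn ⟪w, r⟫ * (⟪y l, r⟫ / √(projSq y r))))) (stdGaussian F) :=
    (integrable_const s).add jpq
  refine ⟨(js.add (integrable_finsetSum _ jt)).const_mul _, ?_⟩
  simp only [Φ]
  rw [integral_const_mul, integral_add js (integrable_finsetSum _ jt),
    integral_add (integrable_const s) jpq, integral_add jp jq, integral_finsetSum _ ip,
    integral_finsetSum _ iq, integral_finsetSum _ jt]
  simp_rw [fun k => integral_finsetSum Finset.univ (it k), integral_const_mul]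
  simp

end Expectation

/-! ### The guarantee for a single term -/

namespace Instance

variable {n d : ℕ} {E : Type*}

lemma orthonormal_siteVec {A : Instance n E} {M : Matrix (Label n) (Label n) ℝ}
    {ρ : E → TwoQubitOp} (h : A.SDPFeasible M ρ) {v : Label n → EuclideanSpace ℝ (Fin d)}
    (hv : IsCholesky M v) (i : Fin n) : Orthonormal ℝ (siteVec v i) := by
  rw [orthonormal_iff_ite]
  intro k l
  rw [siteVec, siteVec, ← hv]
  split_ifs with hkl
  · rw [hkl, h.diag]
  · exact h.diag_block _ _ _ hkl

/-- The rounded state attains, in expectation, a constant fraction of each term. -/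
lemma alpha_mul_le_integral_term {k : ℕ} (hk : k = 1 ∨ k = 2 ∨ k = 3) {A : Instance n E}
    (hA : A.IsProjectorInstance k) {M : Matrix (Label n) (Label n) ℝ} {ρ : E → TwoQubitOp}
    (h : A.SDPFeasible M ρ) {v : Label n → EuclideanSpace ℝ (Fin d)} (hv : IsCholesky M v)
    (e : E) :
    Integrable (fun r => (extend (A.fst e) (A.snd e) (A.op e) * roundedState v r).trace.re)
        (stdGaussian (EuclideanSpace ℝ (Fin d))) ∧
      alpha k * (A.op e * ρ e).trace.re ≤
        ∫ r, (extend (A.fst e) (A.snd e) (A.op e) * roundedState v r).trace.re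
          ∂stdGaussian (EuclideanSpace ℝ (Fin d)) := by
  obtain ⟨-, hP, hrank⟩ := hA e
  have hX := A.isHermitian e
  have hx := orthonormal_siteVec h hv (A.fst e)
  have hy := orthonormal_siteVec h hv (A.snd e)
  have hv0 : ‖v none‖ = 1 := by
    have := h.id_id
    rw [hv, real_inner_self_eq_norm_sq] at this
    exact (pow_eq_one_iff_of_nonneg (norm_nonneg _) two_ne_zero).1 this
  have hrk : (A.op e).trace.re = (A.op e).rank := by
    rw [trace_eq_rank_of_isIdempotentElem hP.isIdempotentElem, Complex.natCast_re]
  have hrk4 : (A.op e).rank ≤ 4 := by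
    simpa using Matrix.rank_le_card_width (A.op e)
  simp_rw [re_trace_extend_mul_roundedState (A.fst_ne_snd e) hX]
  obtain ⟨hint, hval⟩ := integrable_and_integral_rounded (v none) (siteVec v (A.fst e))
    (siteVec v (A.snd e)) (A.op e).trace.re (fun k => pauliTr k.succ 0 (A.op e))
    (fun l => pauliTr 0 l.succ (A.op e)) (fun k l => pauliTr k.succ l.succ (A.op e))
  refine ⟨hint, ?_⟩
  obtain ⟨c, hc1, hc2, hc⟩ := exists_integral_sgn_mul_ratio hx hv0
  obtain ⟨c', hc1', hc2', hc'⟩ := exists_integral_sgn_mul_ratio hy hv0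
  have hT := sum_integral_ratio_mul_ratio_ge hx hy
    (fun k l => pauliTr k.succ l.succ (A.op e))
  simp only at hval
  rw [hval]
  simp_rw [hc, hc']
  have h4 := four_mul_re_trace_mul hX (ρ e)
  obtain ⟨ρ', hρ', hflip⟩ := exists_spinFlip (h.density e)
  have h4' := four_mul_re_trace_mul hX ρ'
  have hone : pauliTr 0 0 (ρ e) = 1 := by
    rw [pauliTr_zero_zero, (h.density e).2, Complex.one_re]
  -- By idempotence this reads `4K = K² + np + nq + nT`, the length constraint `hn` of
  -- `ratio_inequality`.
  have hself := four_mul_re_trace_mul hX (A.op e)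
  rw [hP.isIdempotentElem.eq, pauliTr_zero_zero, hrk] at hself
  simp only [hflip, flipSign, Fin.succ_ne_zero, if_true, if_false, hone] at h4'
  rw [hone] at h4
  simp_rw [← h.one_marginal_fst, ← h.one_marginal_snd, ← h.two_marginal, hv _ _,
    pauliTr_zero_zero, hrk] at h4 h4'
  have hsv : ∀ i k, v (some (i, k)) = siteVec v i k := fun _ _ => rfl
  simp only [hsv, one_mul, mul_one, neg_mul, mul_neg, neg_neg, Finset.sum_neg_distrib] at h4 h4'
  have hrange := re_trace_mul_mem_Icc hP (h.density e)
  have hrange' := re_trace_mul_mem_Icc hP hρ'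
  -- Cauchy–Schwarz, with Bessel's inequality for the unit vector `v none`.
  have hcs : ∀ (z : Fin 3 → EuclideanSpace ℝ (Fin d)), Orthonormal ℝ z → ∀ u : Fin 3 → ℝ,
      (∑ k, u k * ⟪z k, v none⟫) ^ 2 ≤ ∑ k, u k * u k := fun z hz u => by
    have h1 := Finset.sum_mul_sq_le_sq_mul_sq Finset.univ u (fun k => ⟪z k, v none⟫)
    have h2 : projSq z (v none) ≤ 1 := by simpa [hv0] using projSq_le_norm_sq hz (v none)
    refine h1.trans ?_
    simp_rw [← pow_two]
    exact mul_le_of_le_one_right (Finset.sum_nonneg fun _ _ => sq_nonneg _) h2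
  have key := ratio_inequality hk hrank hrk4
    (hcs _ hx fun k => pauliTr k.succ 0 (A.op e))
    (hcs _ hy fun l => pauliTr 0 l.succ (A.op e))
    (T := ∑ k : Fin 3, ∑ l : Fin 3, pauliTr k.succ l.succ (A.op e) *
      ⟪siteVec v (A.fst e) k, siteVec v (A.snd e) l⟫)
    (nT := ∑ k : Fin 3, ∑ l : Fin 3, pauliTr k.succ l.succ (A.op e) ^ 2)
    (by simp_rw [pow_two]; linarith) (c := c) (c' := c')
    (by linarith) (by linarith) (by linarith) (by linarith) hc1 hc2 hc1' hc2'
  have e1 : ∑ k : Fin 3, pauliTr k.succ 0 (A.op e) * (c * ⟪siteVec v (A.fst e) k, v none⟫) =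
      c * ∑ k : Fin 3, pauliTr k.succ 0 (A.op e) * ⟪siteVec v (A.fst e) k, v none⟫ := by
    rw [Finset.mul_sum]
    exact Finset.sum_congr rfl fun _ _ => by ring
  have e2 : ∑ l : Fin 3, pauliTr 0 l.succ (A.op e) * (c' * ⟪siteVec v (A.snd e) l, v none⟫) =
      c' * ∑ l : Fin 3, pauliTr 0 l.succ (A.op e) * ⟪siteVec v (A.snd e) l, v none⟫ := by
    rw [Finset.mul_sum]
    exact Finset.sum_congr rfl fun _ _ => by ring
  rw [e1, e2, hrk, show (A.op e * ρ e).trace.re = 1 / 4 * (4 * (A.op e * ρ e).trace.re) by ring,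
    h4, mul_left_comm]
  refine mul_le_mul_of_nonneg_left ?_ (by norm_num)
  linarith

end Instance

end QLH

/-! ### Summation over the terms and transfer to the law of `r` -/

theorem theorem2p2 (n k : ℕ) (hk : k = 1 ∨ k = 2 ∨ k = 3) {E : Type*} [Fintype E]
    (A : QLH.Instance n E) (hA : A.IsProjectorInstance k)
    (M : Matrix (QLH.Label n) (QLH.Label n) ℝ) (hM : A.IsOptimalMoment M)
    (d : ℕ) (v : QLH.Label n → EuclideanSpace ℝ (Fin d)) (hv : QLH.IsCholesky M v)
    {Ω : Type*} [MeasurableSpace Ω] (μ : MeasureTheory.Measure Ω)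
    (r : Ω → EuclideanSpace ℝ (Fin d))
    (hr : ProbabilityTheory.HasLaw r
      (ProbabilityTheory.stdGaussian (EuclideanSpace ℝ (Fin d))) μ) :
    MeasureTheory.Integrable
        (fun ω => (Matrix.trace (A.hamiltonian * QLH.roundedState v (r ω))).re) μ ∧
      QLH.alpha k *
          ∑ e, A.weight e * (((A.op e).rank : ℝ) / 4 + Matrix.trace (A.valueMatrix e * M)) ≤
        ∫ ω, (Matrix.trace (A.hamiltonian * QLH.roundedState v (r ω))).re ∂μ ∧
      QLH.alpha k * QLH.lambdaMax A.hamiltonian ≤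
        QLH.alpha k *
          ∑ e, A.weight e * (((A.op e).rank : ℝ) / 4 + Matrix.trace (A.valueMatrix e * M)) := by
  obtain ⟨ρ, hρ⟩ := hM.1
  have hobj : ∑ e, A.weight e * (((A.op e).rank : ℝ) / 4 + Matrix.trace (A.valueMatrix e * M)) =
      A.sdpObjective M := by
    refine Finset.sum_congr rfl fun e _ => ?_
    rw [QLH.trace_eq_rank_of_isIdempotentElem (hA e).2.1.isIdempotentElem, Complex.natCast_re]
  have hterm := fun e => QLH.Instance.alpha_mul_le_integral_term hk hA hρ hv e
  have hint : ∀ e ∈ Finset.univ, MeasureTheory.Integrable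
      (fun r => A.weight e *
        (QLH.extend (A.fst e) (A.snd e) (A.op e) * QLH.roundedState v r).trace.re)
      (ProbabilityTheory.stdGaussian (EuclideanSpace ℝ (Fin d))) :=
    fun e _ => (hterm e).1.const_mul _
  have hsum : MeasureTheory.Integrable
      (fun r => (A.hamiltonian * QLH.roundedState v r).trace.re)
      (ProbabilityTheory.stdGaussian (EuclideanSpace ℝ (Fin d))) := by
    simp_rw [QLH.Instance.re_trace_hamiltonian_mul]
    exact MeasureTheory.integrable_finsetSum _ hint
  rw [hobj]
  refine ⟨?_, ?_, mul_le_mul_of_nonneg_left (A.lambdaMax_le_sdpObjective hM)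
    (QLH.alpha_pos hk).le⟩
  · rw [← hr.map_eq] at hsum
    exact hsum.comp_aemeasurable hr.aemeasurable
  · have hcomp := hr.integral_comp hsum.aestronglyMeasurable
    refine le_trans ?_ (le_of_eq hcomp.symm)
    simp_rw [QLH.Instance.re_trace_hamiltonian_mul]
    rw [MeasureTheory.integral_finsetSum _ hint, QLH.Instance.sdpObjective, Finset.mul_sum]
    refine Finset.sum_le_sum fun e _ => ?_
    rw [MeasureTheory.integral_const_mul, hρ.term_eq, mul_left_comm]
    exact mul_le_mul_of_nonneg_left (hterm e).2 (hA e).1
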